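/- Let $G$ be a real Lie group, $H\subset G$ a closed subgroup, $\mathfrak g,\mathfrak h$ their Lie algebras, and let $G/H$ be reductive, with a fixed decomposition $\mathfrak g=\mathfrak h\oplus\mathfrak m$ such that $\operatorname{Ad}(H)(\mathfrak m)=\mathfrak m$; write $x=x_{\mathfrak h}+x_{\mathfrak m}$ for the corresponding decomposition of $x\in\mathfrak g$. Let $\Omega$ be a $G$-invariant symplectic form on $G/H$, and let $\omega$ be the nondegenerate skew-symmetric bilinear form on $\mathfrak m\cong T_H(G/H)$ induced by $\Omega$. Define a product $\mathrm L^{0,1}:\mathfrak m\times\mathfrak m\to\mathfrak m$ by $$\omega\big(\mathrm L^{0,1}_x(y),z\big)=\omega\big([x,z]_{\mathfrak m},y\big),\qquad x,y,z\in\mathfrak m.$$ The Zero-One connection $\nabla^{0,1}$ is the $G$-invariant connection on $G/H$ corresponding to the product $\mathrm L^{0,1}$: for $X,Y$ smooth vector fields and $f_X,f_Y:G\to\mathfrak m$ the functions given by $f_X(g)=(g^{-1})_*X(gH)\in T_H(G/H)\cong\mathfrak m$, the function of $\nabla^{0,1}_XY$ at $g$ is the derivative of $f_Y$ at $g$ in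 the direction $(dL_g)(f_X(g))$ plus $\mathrm L^{0,1}_{f_X(g)}(f_Y(g))$. Theorem. (0) $\nabla^{0,1}$ is a well-defined $G$-invariant connection on $G/H$, and $(\nabla^{0,1}_{x^\#}y^\#-[x^\#,y^\#])(H)=\mathrm L^{0,1}_x(y)$ for all $x,y\in\mathfrak m$, where $x^\#$ is the fundamental vector field of $x$. (1) $\nabla^{0,1}$ is flat (its curvature tensor vanishes) if and only if $[[\mathfrak m,\mathfrak m]_{\mathfrak h},\mathfrak m]=\{0\}$. (2) If $\nabla^{0,1}$ is flat, then $(\mathfrak m,[\cdot,\cdot]_{\mathfrak m})$ is a Lie algebra. (3) Assume moreover that $G/H$ is connected and that $G$ acts almost effectively on $G/H$, i.e. the largest normal subgroup of $G$ contained in $H$ is discrete. Then $\nabla^{0,1}$ is flat if and only if $\mathfrak m$ is an ideal of $\mathfrak g$. -/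

import Mathlib

open scoped Manifold ContDiff Topology

noncomputable section

namespace ReductiveHomogeneous

/-- The model space `ℝⁿ`. -/
abbrev Model (n : ℕ) : Type := EuclideanSpace ℝ (Fin n)

instance leInfty_minSmoothness_three : ENat.LEInfty (minSmoothness ℝ 3) := by
  rw [minSmoothness_of_isRCLikeNormedField]
  infer_instance

/-! ### Homogeneous spaces and reductive decompositions -/

section Homogeneous

/-- The manifold structure on `G ⧸ H` is that of the homogeneous space of the Lie group `G` by
the closed subgroup `H`: the left action of `G` is smooth and the projection `G → G ⧸ H`
(smooth, as an orbit map of the action) is a submersion at `1`, hence everywhere by equivariance.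
For closed `H` there is exactly one such smooth structure. -/
class IsHomogeneousSpace (n k : ℕ) {G : Type*} [TopologicalSpace G] [Group G]
    [ChartedSpace (Model n) G] (H : Subgroup G) [ChartedSpace (Model k) (G ⧸ H)] : Prop where
  isClosed : IsClosed (H : Set G)
  smooth_smul : ContMDiffSMul (𝓡 n) (𝓡 k) ∞ G (G ⧸ H)
  submersion : Function.Surjective
    (mfderiv (𝓡 n) (𝓡 k) (QuotientGroup.mk : G → G ⧸ H) (1 : G))

variable (n k : ℕ) {G : Type*} [TopologicalSpace G] [Group G] [ChartedSpace (Model n) G]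
  (H : Subgroup G) [ChartedSpace (Model k) (G ⧸ H)]

/-- The base point `H` of `G ⧸ H`. -/
abbrev origin : G ⧸ H := QuotientGroup.mk (1 : G)

/-- The differential at `1` of the projection `G → G ⧸ H`, as a map `𝔤 → T_H (G ⧸ H)`. -/
def dproj : GroupLieAlgebra (𝓡 n) G →L[ℝ] TangentSpace (𝓡 k) (origin H) :=
  mfderiv (𝓡 n) (𝓡 k) (QuotientGroup.mk : G → G ⧸ H) (1 : G)

/-- The Lie algebra `𝔥 ⊆ 𝔤` of `H`, i.e. the tangent space at `1` of `H`. As `H` is the fibre over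
the base point of the submersion `G → G ⧸ H`, it is the kernel of the differential at `1`. -/
def isotropyAlgebra : Submodule ℝ (GroupLieAlgebra (𝓡 n) G) :=
  LinearMap.ker (dproj n k H : GroupLieAlgebra (𝓡 n) G →ₗ[ℝ] TangentSpace (𝓡 k) (origin H))

/-- The adjoint representation: `Ad g` is the differential at `1` of `x ↦ g x g⁻¹`. -/
def Ad (g : G) : GroupLieAlgebra (𝓡 n) G →L[ℝ] GroupLieAlgebra (𝓡 n) G :=
  mfderiv (𝓡 n) (𝓡 n) (fun x : G => g * x * g⁻¹) (1 : G)

/-- A reductive decomposition `𝔤 = 𝔥 ⊕ 𝔪` with `Ad(H)(𝔪) = 𝔪`. -/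
structure ReductiveDecomposition where
  /-- the complement `𝔪` of `𝔥` -/
  m : Submodule ℝ (GroupLieAlgebra (𝓡 n) G)
  isCompl : IsCompl (isotropyAlgebra n k H) m
  map_Ad : ∀ h ∈ H,
    m.map (Ad n h : GroupLieAlgebra (𝓡 n) G →ₗ[ℝ] GroupLieAlgebra (𝓡 n) G) = m

end Homogeneous

/-! ### Vector fields, connections and `2`-forms on `G ⧸ H` -/

section Fields

variable {n k : ℕ} {G : Type*} [TopologicalSpace G] [Group G] [ChartedSpace (Model n) G]
  {H : Subgroup G} [ChartedSpace (Model k) (G ⧸ H)]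

/-- Vector fields (not necessarily smooth) on `G ⧸ H`. -/
abbrev VField (k : ℕ) {G : Type*} [TopologicalSpace G] [Group G] (H : Subgroup G)
    [ChartedSpace (Model k) (G ⧸ H)] : Type _ :=
  (p : G ⧸ H) → TangentSpace (𝓡 k) p

/-- Smoothness of a vector field, as a section of the tangent bundle. -/
def IsSmoothField [IsManifold (𝓡 k) ∞ (G ⧸ H)] (X : VField k H) : Prop :=
  ContMDiff (𝓡 k) (𝓡 k).tangent ∞ (fun p => (⟨p, X p⟩ : TangentBundle (𝓡 k) (G ⧸ H)))

/-- Multiplication of a vector field by a function. -/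
def fsmul (φ : G ⧸ H → ℝ) (X : VField k H) : VField k H := fun p => φ p • X p

/-- The differential of the translation `q ↦ g q` of `G ⧸ H` at `p`. -/
def dtrans (k : ℕ) {G : Type*} [TopologicalSpace G] [Group G] {H : Subgroup G}
    [ChartedSpace (Model k) (G ⧸ H)] (g : G) (p : G ⧸ H) :
    TangentSpace (𝓡 k) p →L[ℝ] TangentSpace (𝓡 k) (g • p) :=
  mfderiv (𝓡 k) (𝓡 k) (fun q : G ⧸ H => g • q) p

/-- The push-forward `g_* X` of a vector field: `(g_* X)(p) = dg (X (g⁻¹ p))`. -/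
def pushforward (g : G) (X : VField k H) : VField k H :=
  fun p => (dtrans k g (g⁻¹ • p) (X (g⁻¹ • p)) : Model k)

/-- The fundamental vector field `x^#` of `x ∈ 𝔤`: its value at `p` is the derivative at `1` of
`g ↦ g p` in the direction `x`. -/
def fundamentalField (x : GroupLieAlgebra (𝓡 n) G) : VField k H :=
  fun p => (mfderiv (𝓡 n) (𝓡 k) (fun g : G => g • p) (1 : G) x : Model k)

/-- `∇` is a `G`-invariant (affine) connection on `G ⧸ H`; `∇ X Y` stands for `∇_X Y`. -/
structure IsInvariantConnection [IsManifold (𝓡 k) ∞ (G ⧸ H)]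
    (nab : VField k H → VField k H → VField k H) : Prop where
  smooth : ∀ X Y, IsSmoothField X → IsSmoothField Y → IsSmoothField (nab X Y)
  add_left : ∀ X X' Y, IsSmoothField X → IsSmoothField X' → IsSmoothField Y →
    nab (X + X') Y = nab X Y + nab X' Y
  smul_left : ∀ (φ : G ⧸ H → ℝ) (X Y), ContMDiff (𝓡 k) 𝓘(ℝ, ℝ) ∞ φ →
    IsSmoothField X → IsSmoothField Y → nab (fsmul φ X) Y = fsmul φ (nab X Y)
  add_right : ∀ X Y Y', IsSmoothField X → IsSmoothField Y → IsSmoothField Y' →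
    nab X (Y + Y') = nab X Y + nab X Y'
  leibniz : ∀ (φ : G ⧸ H → ℝ) (X Y), ContMDiff (𝓡 k) 𝓘(ℝ, ℝ) ∞ φ →
    IsSmoothField X → IsSmoothField Y →
    nab X (fsmul φ Y) = fsmul (fun p => mvfderiv (𝓡 k) φ p (X p)) Y + fsmul φ (nab X Y)
  invariant : ∀ (g : G) (X Y), IsSmoothField X → IsSmoothField Y →
    nab (pushforward g X) (pushforward g Y) = pushforward g (nab X Y)

/-- The curvature `K(X, Y) Z = ∇_X ∇_Y Z - ∇_Y ∇_X Z - ∇_{[X, Y]} Z`. -/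
def curvature (nab : VField k H → VField k H → VField k H) (X Y Z : VField k H) : VField k H :=
  nab X (nab Y Z) - nab Y (nab X Z) - nab (VectorField.mlieBracket (𝓡 k) X Y) Z

/-- A connection is flat if its curvature tensor vanishes. -/
def IsFlat [IsManifold (𝓡 k) ∞ (G ⧸ H)] (nab : VField k H → VField k H → VField k H) : Prop :=
  ∀ X Y Z, IsSmoothField X → IsSmoothField Y → IsSmoothField Z → curvature nab X Y Z = 0

/-- Fields of bilinear forms on the tangent spaces of `G ⧸ H`. -/
abbrev TwoTensor (k : ℕ) {G : Type*} [TopologicalSpace G] [Group G] (H : Subgroup G)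
    [ChartedSpace (Model k) (G ⧸ H)] : Type _ :=
  (p : G ⧸ H) → TangentSpace (𝓡 k) p →L[ℝ] TangentSpace (𝓡 k) p →L[ℝ] ℝ

/-- The exterior derivative of a `2`-form `Ω`, evaluated on three vector fields. -/
def extDerivTwo (Om : TwoTensor k H) (X Y Z : VField k H) (p : G ⧸ H) : ℝ :=
  mvfderiv (𝓡 k) (fun q => Om q (Y q) (Z q)) p (X p)
    + mvfderiv (𝓡 k) (fun q => Om q (Z q) (X q)) p (Y p)
    + mvfderiv (𝓡 k) (fun q => Om q (X q) (Y q)) p (Z p)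
    - Om p (VectorField.mlieBracket (𝓡 k) X Y p) (Z p)
    - Om p (VectorField.mlieBracket (𝓡 k) Y Z p) (X p)
    - Om p (VectorField.mlieBracket (𝓡 k) Z X p) (Y p)

variable (k H) in
/-- A `G`-invariant symplectic form on `G ⧸ H`: a smooth, closed, nondegenerate, `G`-invariant
differential `2`-form. -/
structure InvariantSymplecticForm [IsManifold (𝓡 k) ∞ (G ⧸ H)] where
  /-- the underlying bilinear forms on the tangent spaces -/
  form : TwoTensor k H
  smooth : ContMDiff (𝓡 k) ((𝓡 k).prod 𝓘(ℝ, Model k →L[ℝ] Model k →L[ℝ] ℝ)) ∞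
    (fun p => Bundle.TotalSpace.mk' (Model k →L[ℝ] Model k →L[ℝ] ℝ)
      (E := fun p : G ⧸ H => TangentSpace (𝓡 k) p →L[ℝ] TangentSpace (𝓡 k) p →L[ℝ] ℝ)
      p (form p))
  alternating : ∀ (p : G ⧸ H) (v : TangentSpace (𝓡 k) p), form p v v = 0
  nondegenerate : ∀ (p : G ⧸ H) (v : TangentSpace (𝓡 k) p), (∀ w, form p v w = 0) → v = 0
  closed : ∀ X Y Z, IsSmoothField X → IsSmoothField Y → IsSmoothField Z →
    ∀ p, extDerivTwo form X Y Z p = 0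
  invariant : ∀ (g : G) (p : G ⧸ H) (v w : TangentSpace (𝓡 k) p),
    form (g • p) (dtrans k g p v) (dtrans k g p w) = form p v w

end Fields

/-! ### The algebra of `𝔪` -/

section Algebra

variable {n k : ℕ} {G : Type*} [TopologicalSpace G] [Group G] [ChartedSpace (Model n) G]
  {H : Subgroup G} [ChartedSpace (Model k) (G ⧸ H)]

instance finiteDimensional_lie : FiniteDimensional ℝ (GroupLieAlgebra (𝓡 n) G) :=
  inferInstanceAs (FiniteDimensional ℝ (Model n))

namespace ReductiveDecomposition

variable (D : ReductiveDecomposition n k H)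

/-- The projection `x ↦ x_𝔪` of `𝔤` on `𝔪` along `𝔥`. -/
def projM : GroupLieAlgebra (𝓡 n) G →ₗ[ℝ] D.m :=
  D.m.projectionOnto (isotropyAlgebra n k H) D.isCompl.symm

/-- The projection `x ↦ x_𝔥` of `𝔤` on `𝔥` along `𝔪`. -/
def projH : GroupLieAlgebra (𝓡 n) G →ₗ[ℝ] isotropyAlgebra n k H :=
  (isotropyAlgebra n k H).projectionOnto D.m D.isCompl

/-- The bracket `[x, y]_𝔪` on `𝔪`, as a bilinear map. -/
def bracketM [LieGroup (𝓡 n) ∞ G] : D.m →ₗ[ℝ] D.m →ₗ[ℝ] D.m :=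
  LinearMap.mk₂ ℝ
    (fun x y => D.projM ⁅(x : GroupLieAlgebra (𝓡 n) G), (y : GroupLieAlgebra (𝓡 n) G)⁆)
    (fun x x' y => by simp) (fun c x y => by simp) (fun x y y' => by simp) (fun c x y => by simp)

/-- The vector space `𝔪` with the bilinear bracket `[·,·]_𝔪` is a Lie algebra. -/
def IsLieAlgebraM [LieGroup (𝓡 n) ∞ G] : Prop :=
  (∀ x, D.bracketM x x = 0) ∧
  ∀ x y z, D.bracketM x (D.bracketM y z) + D.bracketM y (D.bracketM z x)
    + D.bracketM z (D.bracketM x y) = 0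

/-- `[[𝔪, 𝔪]_𝔥, 𝔪] = {0}`. -/
def BracketCondition : Prop :=
  ∀ x ∈ D.m, ∀ y ∈ D.m, ∀ z ∈ D.m,
    ⁅(D.projH ⁅x, y⁆ : GroupLieAlgebra (𝓡 n) G), z⁆ = 0

/-- `𝔪` is an ideal of `𝔤`. -/
def IsIdealM : Prop := ∀ x : GroupLieAlgebra (𝓡 n) G, ∀ y ∈ D.m, ⁅x, y⁆ ∈ D.m

theorem bijective_dproj_restrict [hs : IsHomogeneousSpace n k H] : Function.Bijective
    ((dproj n k H : GroupLieAlgebra (𝓡 n) G →ₗ[ℝ] TangentSpace (𝓡 k) (origin H)).domRestrict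
      D.m) := by
  constructor
  · rw [← LinearMap.ker_eq_bot, LinearMap.ker_domRestrict, ← Submodule.disjoint_iff_comap_eq_bot]
    exact D.isCompl.symm.disjoint
  · intro v
    obtain ⟨x, hx⟩ := hs.submersion v
    obtain ⟨a, ha, b, hb, hab⟩ := Submodule.mem_sup.1
      (show x ∈ isotropyAlgebra n k H ⊔ D.m by rw [D.isCompl.sup_eq_top]; trivial)
    refine ⟨⟨b, hb⟩, ?_⟩
    have h0 : dproj n k H a = 0 := ha
    have h1 : dproj n k H x = v := hx
    rw [← hab, map_add, h0, zero_add] at h1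
    exact h1

variable [IsHomogeneousSpace n k H]

/-- The identification `𝔪 ≃ T_H (G ⧸ H)` given by the differential of the projection. -/
def tangentEquiv : D.m ≃ₗ[ℝ] TangentSpace (𝓡 k) (origin H) :=
  LinearEquiv.ofBijective _ D.bijective_dproj_restrict

/-- The bilinear form `ω` on `𝔪` induced by `Ω` through `𝔪 ≃ T_H (G ⧸ H)`. -/
def tensor [IsManifold (𝓡 k) ∞ (G ⧸ H)] (Om : InvariantSymplecticForm k H) :
    LinearMap.BilinForm ℝ D.m :=
  LinearMap.mk₂ ℝ (fun x y => Om.form (origin H) (D.tangentEquiv x) (D.tangentEquiv y))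
    (fun x x' y => by simp) (fun c x y => by simp) (fun x y y' => by simp) (fun c x y => by simp)

theorem tensor_nondegenerate [IsManifold (𝓡 k) ∞ (G ⧸ H)] (Om : InvariantSymplecticForm k H) :
    (D.tensor Om).Nondegenerate := by
  have key : ∀ x : D.m, (∀ y, D.tensor Om x y = 0) → x = 0 := by
    intro x hx
    apply D.tangentEquiv.map_eq_zero_iff.1
    apply Om.nondegenerate
    intro w
    have := hx (D.tangentEquiv.symm w)
    simpa [tensor] using this
  have skew : ∀ x y : D.m, D.tensor Om x y = - D.tensor Om y x := by
    intro x y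
    have h := Om.alternating (origin H) (D.tangentEquiv x + D.tangentEquiv y)
    simp only [map_add, add_apply, Om.alternating] at h
    simp only [tensor, LinearMap.mk₂_apply]
    linarith
  refine ⟨key, fun y hy => key y fun x => ?_⟩
  rw [skew, hy x, neg_zero]

/-- The product `L^{a,b}` on `𝔪`, defined by
`ω(L^{a,b}_x(y), z) = a ω([x,y]_𝔪, z) + b ω([x,z]_𝔪, y)`; here `L^{a,b}_x(y)` is
`D.productL Om a b x y`. -/
def productL [LieGroup (𝓡 n) ∞ G] [IsManifold (𝓡 k) ∞ (G ⧸ H)]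
    (Om : InvariantSymplecticForm k H) (a b : ℝ) (x y : D.m) : D.m :=
  ((D.tensor Om).toDual (D.tensor_nondegenerate Om)).symm
    (a • D.tensor Om (D.bracketM x y) + b • ((D.tensor Om).flip y ∘ₗ D.bracketM x))

theorem tensor_productL [LieGroup (𝓡 n) ∞ G] [IsManifold (𝓡 k) ∞ (G ⧸ H)]
    (Om : InvariantSymplecticForm k H) (a b : ℝ) (x y z : D.m) :
    D.tensor Om (D.productL Om a b x y) z =
      a * D.tensor Om (D.bracketM x y) z + b * D.tensor Om (D.bracketM x z) y := by
  rw [productL, LinearMap.BilinForm.apply_toDual_symm_apply]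
  simp

/-- The product on `𝔪` associated with a connection `∇`:
`L^∇_x(y) = (∇_{x^#} y^# - [x^#, y^#])(H)`, with `T_H (G ⧸ H)` identified with `𝔪`. -/
def connectionProduct (nab : VField k H → VField k H → VField k H) (x y : D.m) : D.m :=
  D.tangentEquiv.symm
    (nab (fundamentalField (n := n) (x : GroupLieAlgebra (𝓡 n) G))
        (fundamentalField (n := n) (y : GroupLieAlgebra (𝓡 n) G)) (origin H)
      - VectorField.mlieBracket (𝓡 k)
        (fundamentalField (n := n) (x : GroupLieAlgebra (𝓡 n) G))
        (fundamentalField (n := n) (y : GroupLieAlgebra (𝓡 n) G)) (origin H))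

/-- The function `f_X : G → 𝔪` of a vector field `X` on `G ⧸ H`: `f_X(g) ∈ 𝔪 ≃ T_H (G ⧸ H)` is
the image of `X(gH)` under the differential of translation by `g⁻¹`. It satisfies
`f_X(gh) = Ad(h⁻¹) f_X(g)` for `h ∈ H`, and it determines `X`. -/
def coord (X : VField k H) (g : G) : D.m :=
  D.tangentEquiv.symm
    (dtrans k g⁻¹ (QuotientGroup.mk g : G ⧸ H) (X (QuotientGroup.mk g)) : Model k)

/-- The inclusion of `𝔪` in the model space `ℝⁿ` underlying `𝔤 = T_1 G`. -/
def toModel (x : D.m) : Model n := (x : GroupLieAlgebra (𝓡 n) G)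

/-- `f_{∇_X Y}(g)`, as a vector of `ℝⁿ = 𝔤`, for the invariant connection `∇` with product `L`:
the derivative of `f_Y` at `g` along the horizontal lift `dL_g(f_X(g))` of `X`,
plus `L_{f_X(g)}(f_Y(g))`. -/
def nablaCoord (L : D.m → D.m → D.m) (X Y : VField k H) (g : G) : Model n :=
  mvfderiv (𝓡 n) (fun a : G => D.toModel (D.coord Y a)) g
      (mulInvariantVectorField (D.coord X g : GroupLieAlgebra (𝓡 n) G) g)
    + D.toModel (L (D.coord X g) (D.coord Y g))

/-- The `G`-invariant connection on `G ⧸ H` attached to an `Ad(H)`-invariant bilinear product `L`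
on `𝔪`: `(∇_X Y)(gH)` is the vector `dg (dπ (f_{∇_X Y}(g)))`, which does not depend on the
representative `g` of `gH`. -/
def connectionOf (L : D.m → D.m → D.m) (X Y : VField k H) : VField k H :=
  fun p => (dtrans k p.out (origin H) (dproj n k H (D.nablaCoord L X Y p.out)) : Model k)

/-- The connection `∇^{a,b}`. -/
def nabla [LieGroup (𝓡 n) ∞ G] [IsManifold (𝓡 k) ∞ (G ⧸ H)]
    (Om : InvariantSymplecticForm k H) (a b : ℝ) : VField k H → VField k H → VField k H :=
  D.connectionOf (D.productL Om a b)

/-- The Zero-One connection `∇^{0,1}`. -/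
def zeroOne [LieGroup (𝓡 n) ∞ G] [IsManifold (𝓡 k) ∞ (G ⧸ H)]
    (Om : InvariantSymplecticForm k H) : VField k H → VField k H → VField k H :=
  D.nabla Om 0 1

end ReductiveDecomposition

end Algebra

/-- `G` acts almost effectively on `G ⧸ H`: the largest normal subgroup of `G` contained in `H`
is discrete. -/
def ActsAlmostEffectively {G : Type*} [TopologicalSpace G] [Group G] (H : Subgroup G) : Prop :=
  DiscreteTopology H.normalCore

end ReductiveHomogeneous

end

/-!
A vector field `X` on `G ⧸ H` is the same thing as an `Ad(H)`-equivariant function `f_X : G → 𝔪`: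
`X` is the projection of the field `g ↦ dL_g (f_X g)` on `G`. All computations are made with these
functions, which take values in the fixed vector space `ℝⁿ = 𝔤`; accordingly, linear maps between
tangent spaces are treated as maps between the model spaces. The basic tools are the formula
`mlieBracket_leftVec` for the bracket of two fields on `G` in left trivialisation, the naturality
of the bracket of related fields (`mfderiv_mlieBracket_of_related`), and the formula
`leftDeriv_adInv` for the derivative of `g ↦ Ad(g⁻¹) y`. The last one holds because left- and
right-invariant fields commute.

*The connection.* The function of `∇_X Y` is `D_{f_X} f_Y + L(f_X, f_Y)`. It is equivariant, as `L`
is `Ad(H)`-invariant, and smooth, so it defines a smooth field, since `G → G ⧸ H` has smooth local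
sections (`isSmoothField_of_lift`). The axioms of an invariant connection are then read off on `G`
(`isInvariantConnection_zeroOne`). The fundamental field of `x` corresponds to the projection to `𝔪`
of `g ↦ Ad(g⁻¹) x`, which gives the product of the connection (`connectionProduct_zeroOne`).

*Flatness.* Along vectors of `𝔥` an equivariant function has a derivative given by the bracket
(`leftDeriv_of_isotropy`). Hence the curvature is given, in terms of `f_X, f_Y, f_Z`, by
`K(x, y) z = -[[x, y]_𝔥, z] + L_x L_y z - L_y L_x z - L_{[x, y]_𝔪} z` (`coordM_curvature`).
Now `L_x` is minus the `ω`-adjoint of `y ↦ [x, y]_𝔪`, while `y ↦ [v, y]` is skew for `ω` if `v ∈ 𝔥`.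
By the Jacobi identity, all that remains is
`ω(K(x, y) z, w) = ω([[y, w]_𝔥, x] - [[x, w]_𝔥, y], z)` (`omM_curvM`). So `∇` is flat if and only if
the trilinear map `(x, w, y) ↦ [[x, w]_𝔥, y]` on `𝔪` is symmetric in `x` and `y`. As it is
skew in `x` and `w`, it must vanish, which is the condition `[[𝔪, 𝔪]_𝔥, 𝔪] = 0`. Under this
condition the `𝔥`-components drop out of the Jacobi identity for `[·,·]_𝔪`.

*Almost effective actions.* The centraliser `𝔞` of `𝔪` in `𝔥` is an ideal of `𝔤`. By Grönwall's
inequality an ideal is stable under `Ad(g)` for `g` near `1` (`eventually_adInv_mem`); as `𝔞` is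
also stable under `Ad(H)` and `G ⧸ H` is connected, it is stable under `Ad(G)`. The integral curve
through `1` of the left-invariant field of a vector of `𝔞` therefore acts trivially on `G ⧸ H`, so
it lies in the largest normal subgroup contained in `H`. If this group is discrete, the curve is
constant; hence `𝔞 = 0` (`centralizerM_eq_zero`). If `∇` is flat, then `[𝔪, 𝔪]_𝔥 ⊆ 𝔞 = 0`, and
with `[𝔥, 𝔪] ⊆ 𝔪` it follows that `𝔪` is an ideal.
-/

set_option linter.unusedSectionVars false

noncomputable section

namespace ReductiveHomogeneous

open Bundle VectorField Set

/-! ### Calculus of vector fields on manifolds -/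

section ManifoldCalculus

variable {E : Type*} [NormedAddCommGroup E] [NormedSpace ℝ E] {EH : Type*} [TopologicalSpace EH]
  {I : ModelWithCorners ℝ E EH} {M : Type*} [TopologicalSpace M] [ChartedSpace EH M]
  {E' : Type*} [NormedAddCommGroup E'] [NormedSpace ℝ E'] {EH' : Type*} [TopologicalSpace EH']
  {I' : ModelWithCorners ℝ E' EH'} {M' : Type*} [TopologicalSpace M'] [ChartedSpace EH' M']
  {F : Type*} [NormedAddCommGroup F] [NormedSpace ℝ F]

/-- The chain rule for the derivative of a vector-valued function. -/
theorem mvfderiv_comp_apply' {f : M → F} {φ : M' → M} (x : M')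
    (hf : MDifferentiableAt I 𝓘(ℝ, F) f (φ x)) (hφ : MDifferentiableAt I' I φ x)
    (v : TangentSpace I' x) :
    mvfderiv I' (fun y => f (φ y)) x v = mvfderiv I f (φ x) (mfderiv I' I φ x v) :=
  mfderiv_comp_apply x hf hφ v

/-- The chain rule for post-composition with a continuous linear map. -/
theorem mvfderiv_clm_comp {F' : Type*} [NormedAddCommGroup F'] [NormedSpace ℝ F'] (A : F →L[ℝ] F')
    {f : M → F} {x : M} (hf : MDifferentiableAt I 𝓘(ℝ, F) f x) (v : TangentSpace I x) :
    mvfderiv I (fun y => A (f y)) x v = A (mvfderiv I f x v) := by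
  have h := mfderiv_comp_apply x (A.mdifferentiableAt (x := f x)) hf v
  rw [A.mfderiv_eq] at h
  exact h

variable (I) in
/-- The representative of a vector field in the preferred chart around `x`. -/
def chartField (U : (x : M) → TangentSpace I x) (x : M) : E → E :=
  mpullbackWithin 𝓘(ℝ, E) I (extChartAt I x).symm U (range I)

theorem mvfderiv_apply_eq_fderiv_chart [I.Boundaryless] {g : M → F} {x : M}
    (hg : MDifferentiableAt I 𝓘(ℝ, F) g x) (v : TangentSpace I x) :
    mvfderiv I g x v = fderiv ℝ (g ∘ (extChartAt I x).symm) (extChartAt I x x) v := by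
  rw [hg.mvfderiv, I.range_eq_univ, fderivWithin_univ]
  rfl

theorem chartField_self [IsManifold I 1 M] (U : (x : M) → TangentSpace I x) (x : M) :
    chartField I U x (extChartAt I x x) = U x := by
  have h : ∀ z : M, z = x → ∀ L : E →L[ℝ] E, L = ContinuousLinearMap.id ℝ E →
     L.inverse (U z) = U x := by
    rintro z rfl L rfl
    rw [ContinuousLinearMap.inverse_id]; rfl
  exact h _ (extChartAt_to_inv x) _ (mfderivWithin_range_extChartAt_symm (I := I) (x := x))

theorem differentiableAt_chartField [I.Boundaryless] [CompleteSpace E] [IsManifold I 2 M]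
    {U : (x : M) → TangentSpace I x} {x : M}
    (hU : MDifferentiableAt I I.tangent (fun y => (⟨y, U y⟩ : TangentBundle I M)) x) :
    DifferentiableAt ℝ (chartField I U x) (extChartAt I x x) := by
  have h : ∀ s : Set E, s = univ →
      DifferentiableWithinAt ℝ (chartField I U x) s (extChartAt I x x) →
      DifferentiableAt ℝ (chartField I U x) (extChartAt I x x) := by
    rintro s rfl hs
    rwa [differentiableWithinAt_univ] at hs
  refine h _ ?_
    (mdifferentiableWithinAt_univ.2 hU).differentiableWithinAt_mpullbackWithin_vectorField
  rw [I.range_eq_univ, preimage_univ, univ_inter]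

/-- The Lie bracket at the centre of a chart, in terms of the representatives of the fields. -/
theorem mlieBracket_eq_chartField [I.Boundaryless] [IsManifold I 1 M]
    (V W : (x : M) → TangentSpace I x) (x : M) :
    mlieBracket I V W x =
      lieBracket ℝ (chartField I V x) (chartField I W x) (extChartAt I x x) := by
  rw [← mlieBracketWithin_univ, mlieBracketWithin_apply, preimage_univ, univ_inter]
  have h : ∀ L : E →L[ℝ] E, L = ContinuousLinearMap.id ℝ E → ∀ s : Set E, s = univ →
     L.inverse (lieBracketWithin ℝ (chartField I V x) (chartField I W x) s (extChartAt I x x))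
      = lieBracket ℝ (chartField I V x) (chartField I W x) (extChartAt I x x) := by
    rintro L rfl s rfl
    rw [ContinuousLinearMap.inverse_id, lieBracketWithin_univ]; rfl
  exact h _ (mfderiv_extChartAt_self (I := I)) _ I.range_eq_univ

/-- In a chart, the derivative of a function along a vector field is the derivative of its
representative along the representative of the field. -/
theorem mvfderiv_field_eventually [I.Boundaryless] [IsManifold I 1 M]
    (U : (x : M) → TangentSpace I x) {f : M → F} {x : M}
    (hf : ∀ᶠ y in 𝓝 x, MDifferentiableAt I 𝓘(ℝ, F) f y) :
    ∀ᶠ z in 𝓝 (extChartAt I x x), mvfderiv I f ((extChartAt I x).symm z)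
      (U ((extChartAt I x).symm z)) =
        fderiv ℝ (f ∘ (extChartAt I x).symm) z (chartField I U x z) := by
  have hc : ContinuousAt (extChartAt I x).symm (extChartAt I x x) :=
    continuousAt_extChartAt_symm x
  have h1 : ∀ᶠ z in 𝓝 (extChartAt I x x),
      MDifferentiableAt I 𝓘(ℝ, F) f ((extChartAt I x).symm z) := by
    refine hc.eventually ?_
    rwa [extChartAt_to_inv]
  filter_upwards [h1, extChartAt_target_mem_nhds (I := I) x] with z hz hzt
  have hs : MDifferentiableAt 𝓘(ℝ, E) I (extChartAt I x).symm z := by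
    have := mdifferentiableWithinAt_extChartAt_symm (I := I) hzt
    rwa [I.range_eq_univ, mdifferentiableWithinAt_univ] at this
  have hinv := isInvertible_mfderivWithin_extChartAt_symm (I := I) hzt
  rw [I.range_eq_univ, mfderivWithin_univ] at hinv
  have h2 : ∀ w : E, mvfderiv I f ((extChartAt I x).symm z)
        (mfderiv 𝓘(ℝ, E) I (extChartAt I x).symm z w) =
      fderiv ℝ (f ∘ (extChartAt I x).symm) z w := by
    intro w
    have := mfderiv_comp_apply z hz hs w
    rw [mfderiv_eq_fderiv] at this
    exact this.symm
  rw [← h2]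
  have h3 : mfderiv 𝓘(ℝ, E) I (extChartAt I x).symm z (chartField (E := E) I U x z) =
      U ((extChartAt I x).symm z) := by
    have h4 : ∀ L : E →L[ℝ] E, L.IsInvertible → ∀ v, L (L.inverse v) = v := by
      rintro L ⟨e, he⟩ v
      subst he
      rw [ContinuousLinearMap.inverse_equiv]
      exact (e : E ≃L[ℝ] E).apply_symm_apply v
    have h : ∀ s : Set E, s = univ →
        (mfderiv 𝓘(ℝ, E) I (extChartAt I x).symm z
          (mpullbackWithin 𝓘(ℝ, E) I (extChartAt I x).symm U s z)) =
            U ((extChartAt I x).symm z) := by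
      rintro s rfl
      rw [mpullbackWithin_univ, mpullback_apply]
      exact h4 _ hinv _
    exact h _ I.range_eq_univ
  rw [h3]

theorem contDiffAt_comp_extChartAt_symm [I.Boundaryless] [IsManifold I ∞ M] {f : M → F} {x : M}
    (hf : ContMDiffAt I 𝓘(ℝ, F) ∞ f x) :
    ContDiffAt ℝ ∞ (f ∘ (extChartAt I x).symm) (extChartAt I x x) := by
  rw [← contMDiffAt_iff_contDiffAt]
  refine ContMDiffAt.comp _ (I' := I) ?_ ?_
  · rwa [extChartAt_to_inv]
  · have := contMDiffWithinAt_extChartAt_symm_range (n := ∞) x (mem_extChartAt_target (I := I) x)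
    rwa [I.range_eq_univ, contMDiffWithinAt_univ] at this

theorem eventually_mdifferentiableAt [IsManifold I ∞ M] [IsManifold I' ∞ M'] {f : M → M'} {x : M}
    (hf : ContMDiffAt I I' ∞ f x) : ∀ᶠ y in 𝓝 x, MDifferentiableAt I I' f y := by
  have h1 : ContMDiffAt I I' 1 f x := hf.of_le (by simp)
  filter_upwards [contMDiffAt_iff_contMDiffAt_nhds (by simp) |>.1 h1] with y hy
  exact hy.mdifferentiableAt (by simp)

theorem differentiableAt_fderiv_chartField [I.Boundaryless] [CompleteSpace E] [IsManifold I ∞ M]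
    {U : (x : M) → TangentSpace I x} {f : M → F} {x : M}
    (hf : ContMDiffAt I 𝓘(ℝ, F) ∞ f x)
    (hU : MDifferentiableAt I I.tangent (fun y => (⟨y, U y⟩ : TangentBundle I M)) x) :
    DifferentiableAt ℝ (fun z => fderiv ℝ (f ∘ (extChartAt I x).symm) z (chartField I U x z))
      (extChartAt I x x) :=
  (((contDiffAt_comp_extChartAt_symm hf).fderiv_right (m := 1)
    (by rw [one_add_one_eq_two]; exact ENat.LEInfty.out)).differentiableAt (by simp)).clm_apply
      (differentiableAt_chartField hU)

theorem mdifferentiableAt_mvfderiv_field [I.Boundaryless] [CompleteSpace E] [IsManifold I ∞ M]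
    {U : (x : M) → TangentSpace I x} {f : M → F} {x : M}
    (hf : ContMDiffAt I 𝓘(ℝ, F) ∞ f x)
    (hU : MDifferentiableAt I I.tangent (fun y => (⟨y, U y⟩ : TangentBundle I M)) x) :
    MDifferentiableAt I 𝓘(ℝ, F) (fun y => mvfderiv I f y (U y)) x := by
  have h1 : MDifferentiableAt I 𝓘(ℝ, F) ((fun z => fderiv ℝ (f ∘ (extChartAt I x).symm) z
      (chartField I U x z)) ∘ (extChartAt I x)) x :=
    (differentiableAt_fderiv_chartField hf hU).mdifferentiableAt.comp x
      (mdifferentiableAt_extChartAt (mem_chart_source _ x))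
  refine h1.congr_of_eventuallyEq ?_
  filter_upwards [(continuousAt_extChartAt (I := I) x).eventually
      (mvfderiv_field_eventually U (eventually_mdifferentiableAt hf)),
    extChartAt_source_mem_nhds (I := I) x] with y hy hys
  rw [Function.comp_apply, ← hy, (extChartAt I x).left_inv hys]

/-- The Lie bracket acts on functions as the commutator of the derivations. -/
theorem mvfderiv_mlieBracket_apply [I.Boundaryless] [CompleteSpace E] [IsManifold I ∞ M]
    {V W : (x : M) → TangentSpace I x} {f : M → F} {x : M}
    (hf : ContMDiffAt I 𝓘(ℝ, F) ∞ f x)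
    (hV : MDifferentiableAt I I.tangent (fun y => (⟨y, V y⟩ : TangentBundle I M)) x)
    (hW : MDifferentiableAt I I.tangent (fun y => (⟨y, W y⟩ : TangentBundle I M)) x) :
    mvfderiv I f x (mlieBracket I V W x) =
      mvfderiv I (fun y => mvfderiv I f y (W y)) x (V x)
        - mvfderiv I (fun y => mvfderiv I f y (V y)) x (W x) := by
  have hdiff : ∀ (U : (x : M) → TangentSpace I x),
      MDifferentiableAt I I.tangent (fun y => (⟨y, U y⟩ : TangentBundle I M)) x →
      ∀ v : TangentSpace I x, mvfderiv I (fun y => mvfderiv I f y (U y)) x v =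
        fderiv ℝ (fun z => fderiv ℝ (f ∘ (extChartAt I x).symm) z (chartField I U x z))
          (extChartAt I x x) v := by
    intro U hU v
    rw [mvfderiv_apply_eq_fderiv_chart (mdifferentiableAt_mvfderiv_field hf hU)]
    congr 1
    exact Filter.EventuallyEq.fderiv_eq
      (mvfderiv_field_eventually U (eventually_mdifferentiableAt hf))
  have h1 := fderiv_apply_lieBracket (contDiffAt_comp_extChartAt_symm hf)
    (by simpa using ENat.LEInfty.out) (differentiableAt_chartField hW)
    (differentiableAt_chartField hV)
  rw [mvfderiv_apply_eq_fderiv_chart (hf.mdifferentiableAt (by simp)), mlieBracket_eq_chartField,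
    hdiff V hV, hdiff W hW]
  rw [chartField_self, chartField_self] at h1
  exact h1

/-- Lie brackets of `φ`-related vector fields are `φ`-related, for an arbitrary smooth map `φ`. -/
theorem mfderiv_mlieBracket_of_related [I.Boundaryless] [CompleteSpace E] [IsManifold I ∞ M]
    [I'.Boundaryless] [CompleteSpace E'] [IsManifold I' ∞ M'] {φ : M → M'} {x : M}
    {V W : (x : M) → TangentSpace I x} {V' W' : (x : M') → TangentSpace I' x}
    (hφ : ContMDiffAt I I' ∞ φ x)
    (hV : MDifferentiableAt I I.tangent (fun y => (⟨y, V y⟩ : TangentBundle I M)) x)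
    (hW : MDifferentiableAt I I.tangent (fun y => (⟨y, W y⟩ : TangentBundle I M)) x)
    (hV' : MDifferentiableAt I' I'.tangent (fun y => (⟨y, V' y⟩ : TangentBundle I' M')) (φ x))
    (hW' : MDifferentiableAt I' I'.tangent (fun y => (⟨y, W' y⟩ : TangentBundle I' M')) (φ x))
    (hVV' : ∀ y, mfderiv I I' φ y (V y) = V' (φ y))
    (hWW' : ∀ y, mfderiv I I' φ y (W y) = W' (φ y)) :
    mfderiv I I' φ x (mlieBracket I V W x) = mlieBracket I' V' W' (φ x) := by
  set f : M' → E' := fun y => extChartAt I' (φ x) y with hf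
  have hfs : ContMDiffAt I' 𝓘(ℝ, E') ∞ f (φ x) := contMDiffAt_extChartAt
  have hφd := hφ.mdifferentiableAt (by simp)
  -- the derivative of the chart at its centre is the identity of the model space
  have hinj : ∀ u v : TangentSpace I' (φ x),
      mvfderiv I' f (φ x) u = mvfderiv I' f (φ x) v → u = v := by
    intro u v huv
    have h : ∀ L : E' →L[ℝ] E', L = ContinuousLinearMap.id ℝ E' → L u = L v → u = v := by
      rintro L rfl h; exact h
    exact h _ (mfderiv_extChartAt_self (I := I')) huv
  apply hinj
  have hder : ∀ (U : (x : M) → TangentSpace I x) (U' : (x : M') → TangentSpace I' x),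
      (∀ y, mfderiv I I' φ y (U y) = U' (φ y)) →
      ∀ᶠ y in 𝓝 x, mvfderiv I (fun z => f (φ z)) y (U y) = mvfderiv I' f (φ y) (U' (φ y)) := by
    intro U U' hU
    filter_upwards [hφ.continuousAt.eventually (eventually_mdifferentiableAt hfs),
      eventually_mdifferentiableAt hφ] with y hy1 hy2
    rw [mvfderiv_comp_apply' y hy1 hy2, hU]
  have hder2 : ∀ (A B : (x : M) → TangentSpace I x) (A' B' : (x : M') → TangentSpace I' x),
      MDifferentiableAt I' I'.tangent (fun y => (⟨y, B' y⟩ : TangentBundle I' M')) (φ x) →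
      (∀ y, mfderiv I I' φ y (A y) = A' (φ y)) → (∀ y, mfderiv I I' φ y (B y) = B' (φ y)) →
      mvfderiv I (fun y => mvfderiv I (fun z => f (φ z)) y (B y)) x (A x) =
        mvfderiv I' (fun y => mvfderiv I' f y (B' y)) (φ x) (A' (φ x)) := by
    intro A B A' B' hB' hA hB
    have h1 : mvfderiv I (fun y => mvfderiv I (fun z => f (φ z)) y (B y)) x =
        mvfderiv I (fun y => mvfderiv I' f (φ y) (B' (φ y))) x :=
      Filter.EventuallyEq.mfderiv_eq (hder B B' hB)
    rw [h1, mvfderiv_comp_apply' (f := fun y => mvfderiv I' f y (B' y)) x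
      (mdifferentiableAt_mvfderiv_field hfs hB') hφd, hA]
  rw [← mvfderiv_comp_apply' x (hfs.mdifferentiableAt (by simp)) hφd,
    mvfderiv_mlieBracket_apply (f := fun z => f (φ z)) (hfs.comp x hφ) hV hW,
    mvfderiv_mlieBracket_apply hfs hV' hW',
    hder2 V W V' W' hW' hVV' hWW', hder2 W V W' V' hV' hWW' hVV']

/-- The differential of a smooth map `M × M' → N`, applied to a pair of smooth families of tangent
vectors of `M` and `M'`, is a smooth family of tangent vectors of `N`. -/
theorem contMDiffAt_mfderiv_prod [IsManifold I ∞ M] [IsManifold I' ∞ M']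
    {E'' : Type*} [NormedAddCommGroup E''] [NormedSpace ℝ E'']
    {EH'' : Type*} [TopologicalSpace EH'']
    {J : ModelWithCorners ℝ E'' EH''} {N : Type*} [TopologicalSpace N] [ChartedSpace EH'' N]
    [IsManifold J ∞ N]
    {EQ : Type*} [NormedAddCommGroup EQ] [NormedSpace ℝ EQ] {HQ : Type*} [TopologicalSpace HQ]
    {K : ModelWithCorners ℝ EQ HQ} {Q : Type*} [TopologicalSpace Q] [ChartedSpace HQ Q]
    {Φ : M × M' → N} (hΦ : ContMDiff (I.prod I') J ∞ Φ)
    {a : Q → TangentBundle I M} {b : Q → TangentBundle I' M'} {q : Q}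
    (ha : ContMDiffAt K I.tangent ∞ a q) (hb : ContMDiffAt K I'.tangent ∞ b q) :
    ContMDiffAt K J.tangent ∞ (fun q => (⟨Φ ((a q).1, (b q).1),
      (mfderiv I J (fun z => Φ (z, (b q).1)) (a q).1 (a q).2
        + mfderiv I' J (fun z => Φ ((a q).1, z)) (b q).1 (b q).2)⟩ : TangentBundle J N)) q := by
  have h1 : ContMDiff (I.prod I').tangent J.tangent ∞ (tangentMap (I.prod I') J Φ) :=
    hΦ.contMDiff_tangentMap (by simp)
  have h2 : ContMDiffAt K (I.prod I').tangent ∞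
      (fun q => (equivTangentBundleProd I M I' M').symm (a q, b q)) q :=
    (contMDiff_equivTangentBundleProd_symm (a q, b q)).comp q (ha.prodMk hb)
  refine ((h1 _).comp q h2).congr_of_eventuallyEq (Filter.Eventually.of_forall fun q => ?_)
  have h3 := mfderiv_prod_eq_add_apply (p := ((a q).1, (b q).1)) (E := E) (E' := E') (I := I)
    (I' := I') (I'' := J) (f := Φ) (v := (((a q).2 : E), ((b q).2 : E')))
    ((hΦ _).mdifferentiableAt (by simp))
  exact congrArg (fun w => (⟨Φ ((a q).1, (b q).1), w⟩ : TangentBundle J N)) h3.symm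

/-- The trivialisation of the tangent bundle around `p` is the identity on the tangent space at
`p`. -/
theorem trivializationAt_self_apply [IsManifold I 1 M] (p : M) (w : E) :
    (trivializationAt E (TangentSpace I : M → Type _) p (⟨p, w⟩ : TangentBundle I M)).2 = w := by
  rw [TangentBundle.trivializationAt_apply]
  have h := fderivWithin_extChartAt_comp_extChartAt_symm_range (I := I) (x := p)
  exact congrArg (fun L : E →L[ℝ] E => L w) h

/-- A vector-valued function is smooth if and only if it is so as a family of tangent vectors at a
fixed point. -/
theorem contMDiffAt_tangent_const_iff [IsManifold I ∞ M] (p : M) {w : M' → E}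
    {q : M'} : ContMDiffAt I' I.tangent ∞ (fun y => (⟨p, w y⟩ : TangentBundle I M)) q ↔
      ContMDiffAt I' 𝓘(ℝ, E) ∞ w q := by
  rw [contMDiffAt_totalSpace]
  have h : (fun y => (trivializationAt E (TangentSpace I : M → Type _) p
      (⟨p, w y⟩ : TangentBundle I M)).2) = w := funext fun y => trivializationAt_self_apply p (w y)
  refine ⟨fun hw => ?_, fun hw => ⟨contMDiffAt_const, ?_⟩⟩
  · have := hw.2
    rwa [h] at this
  · rwa [← h] at hw

theorem contMDiff_mvfderiv_field [IsManifold I ∞ M] {f : M → F} {U : (x : M) → TangentSpace I x}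
    (hf : ContMDiff I 𝓘(ℝ, F) ∞ f)
    (hU : ContMDiff I I.tangent ∞ (fun y => (⟨y, U y⟩ : TangentBundle I M))) :
    ContMDiff I 𝓘(ℝ, F) ∞ (fun y => mvfderiv I f y (U y)) :=
  (contMDiff_snd_tangentBundle_modelSpace F 𝓘(ℝ, F)).comp
    ((hf.contMDiff_tangentMap (m := ∞) (by simp)).comp hU)

/-- Two vector fields on `N` commute if they are related, under a smooth map `M × M' → N`, to a
vector field on `M` and a vector field on `M'`. -/
theorem mlieBracket_eq_zero_of_related_prod [I.Boundaryless] [CompleteSpace E] [IsManifold I ∞ M]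
    [I'.Boundaryless] [CompleteSpace E'] [IsManifold I' ∞ M']
    {V : (x : M) → TangentSpace I x} {W : (x : M') → TangentSpace I' x}
    (hV : ContMDiff I I.tangent ∞ (fun y => (⟨y, V y⟩ : TangentBundle I M)))
    (hW : ContMDiff I' I'.tangent ∞ (fun y => (⟨y, W y⟩ : TangentBundle I' M')))
    {N : Type*} {E'' : Type*} [NormedAddCommGroup E''] [NormedSpace ℝ E''] [CompleteSpace E'']
    {EH'' : Type*} [TopologicalSpace EH'']
    {J : ModelWithCorners ℝ E'' EH''} [J.Boundaryless] [TopologicalSpace N] [ChartedSpace EH'' N]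
    [IsManifold J ∞ N] {Φ : M × M' → N} (hΦ : ContMDiff (I.prod I') J ∞ Φ)
    {A B : (x : N) → TangentSpace J x} (p : M × M')
    (hA : MDifferentiableAt J J.tangent (fun y => (⟨y, A y⟩ : TangentBundle J N)) (Φ p))
    (hB : MDifferentiableAt J J.tangent (fun y => (⟨y, B y⟩ : TangentBundle J N)) (Φ p))
    (hVA : ∀ x y, mfderiv I J (fun z => Φ (z, y)) x (V x) = A (Φ (x, y)))
    (hWB : ∀ x y, mfderiv I' J (fun z => Φ (x, z)) y (W y) = B (Φ (x, y))) :
    mlieBracket J A B (Φ p) = 0 := by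
  have hV0 : ContMDiff (I.prod I') (I.prod I').tangent ∞
      (fun q : M × M' => (⟨q, ((V q.1 : E), (0 : E'))⟩ : TangentBundle (I.prod I') (M × M'))) :=
    contMDiff_equivTangentBundleProd_symm.comp
      ((hV.comp contMDiff_fst).prodMk
        ((contMDiff_zeroSection ℝ (TangentSpace I' : M' → Type _)).comp contMDiff_snd))
  have hW0 : ContMDiff (I.prod I') (I.prod I').tangent ∞
      (fun q : M × M' => (⟨q, ((0 : E), (W q.2 : E'))⟩ : TangentBundle (I.prod I') (M × M'))) :=
    contMDiff_equivTangentBundleProd_symm.comp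
      (((contMDiff_zeroSection ℝ (TangentSpace I : M → Type _)).comp contMDiff_fst).prodMk
        (hW.comp contMDiff_snd))
  have hVd := (hV0 p).mdifferentiableAt (by simp)
  have hWd := (hW0 p).mdifferentiableAt (by simp)
  set V0 : (q : M × M') → TangentSpace (I.prod I') q := fun q => ((V q.1 : E), (0 : E'))
  set W0 : (q : M × M') → TangentSpace (I.prod I') q := fun q => ((0 : E), (W q.2 : E'))
  have h1 : mfderiv (I.prod I') I Prod.fst p (mlieBracket (I.prod I') V0 W0 p) = 0 := by
    rw [mfderiv_mlieBracket_of_related (V' := V) (W' := 0) contMDiffAt_fst hVd hWd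
      ((hV _).mdifferentiableAt (by simp))
      ((contMDiff_zeroSection (n := ∞) ℝ (TangentSpace I : M → Type _) _).mdifferentiableAt
        (by simp)), mlieBracket_zero_right]
    · rfl
    · intro y; rw [mfderiv_fst]; rfl
    · intro y; rw [mfderiv_fst]; rfl
  have h2 : mfderiv (I.prod I') I' Prod.snd p (mlieBracket (I.prod I') V0 W0 p) = 0 := by
    rw [mfderiv_mlieBracket_of_related (V' := 0) (W' := W) contMDiffAt_snd hVd hWd
      ((contMDiff_zeroSection (n := ∞) ℝ (TangentSpace I' : M' → Type _) _).mdifferentiableAt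
        (by simp)) ((hW _).mdifferentiableAt (by simp)), mlieBracket_zero_left]
    · rfl
    · intro y; rw [mfderiv_snd]; rfl
    · intro y; rw [mfderiv_snd]; rfl
  have h0 : mlieBracket (I.prod I') V0 W0 p = 0 := by
    rw [mfderiv_fst] at h1
    rw [mfderiv_snd] at h2
    exact Prod.ext h1 h2
  have hadd := fun (y : M × M') (v : TangentSpace (I.prod I') y) =>
    mfderiv_prod_eq_add_apply (v := v) ((hΦ y).mdifferentiableAt (by simp))
  rw [← mfderiv_mlieBracket_of_related (V' := A) (W' := B) (hΦ p) hVd hWd hA hB, h0, map_zero]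
  · intro y
    have h3 : mfderiv I' J (fun z => Φ (y.1, z)) y.2 (0 : TangentSpace I' y.2) = 0 := map_zero _
    refine (hadd y (V0 y)).trans (Eq.trans ?_ (hVA y.1 y.2))
    exact (congrArg _ h3).trans (add_zero _)
  · intro y
    have h3 : mfderiv I J (fun z => Φ (z, y.2)) y.1 (0 : TangentSpace I y.1) = 0 := map_zero _
    refine (hadd y (W0 y)).trans (Eq.trans ?_ (hWB y.1 y.2))
    exact (congrArg (· + _) h3).trans (zero_add _)

end ManifoldCalculus

/-! ### Local sections and integral curves -/

section SectionsAndCurves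

variable {E : Type*} [NormedAddCommGroup E] [NormedSpace ℝ E] {EH : Type*} [TopologicalSpace EH]
  {I : ModelWithCorners ℝ E EH} {M : Type*} [TopologicalSpace M] [ChartedSpace EH M]
  {E' : Type*} [NormedAddCommGroup E'] [NormedSpace ℝ E'] {EH' : Type*} [TopologicalSpace EH']
  {I' : ModelWithCorners ℝ E' EH'} {M' : Type*} [TopologicalSpace M'] [ChartedSpace EH' M']

/-- The inverse function theorem, for a map with surjective derivative: it has a smooth local right
inverse. -/
theorem exists_contDiffAt_right_inverse [FiniteDimensional ℝ E'] [CompleteSpace E']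
    {f : E → E'} {a : E} (hf : ContDiffAt ℝ ∞ f a)
    (hs : Function.Surjective (fderiv ℝ f a)) :
    ∃ s : E' → E, s (f a) = a ∧ ContDiffAt ℝ ∞ s (f a) ∧ ∀ᶠ y in 𝓝 (f a), f (s y) = y := by
  obtain ⟨A, hA⟩ := (fderiv ℝ f a).exists_rightInverse_of_surjective
    (LinearMap.range_eq_top.2 hs)
  set h : E' → E' := fun u => f (a + A u) with hh
  have h0 : h 0 = f a := by simp [hh]
  have haff : ContDiffAt ℝ ∞ (fun u => a + A u) (0 : E') :=
    contDiffAt_const.add A.contDiff.contDiffAt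
  have hhs : ContDiffAt ℝ ∞ h 0 := by
    refine ContDiffAt.comp _ ?_ haff
    simpa using hf
  have hd : HasFDerivAt h ((ContinuousLinearEquiv.refl ℝ E' : E' ≃L[ℝ] E') : E' →L[ℝ] E') 0 := by
    have h1 : HasFDerivAt f (fderiv ℝ f a) (a + A 0) := by
      simpa using (hf.differentiableAt (by simp)).hasFDerivAt
    have h2 : HasFDerivAt (fun u => a + A u) A (0 : E') := A.hasFDerivAt.const_add a
    have h3 := h1.comp 0 h2
    rw [hA] at h3
    exact h3
  set g := hhs.localInverse hd (by simp) with hg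
  have hg0 : g (f a) = 0 := by
    rw [← h0]; exact hhs.localInverse_apply_image hd (by simp)
  refine ⟨fun y => a + A (g y), by simp [hg0], ?_, ?_⟩
  · refine contDiffAt_const.add (A.contDiff.contDiffAt.comp _ ?_)
    rw [← h0]
    exact hhs.to_localInverse hd (by simp)
  · rw [← h0]
    exact (hhs.toOpenPartialHomeomorph h hd (by simp)).eventually_right_inverse'
      (hhs.mem_toOpenPartialHomeomorph_source hd (by simp))

/-- A smooth map whose derivative at a point is surjective has a smooth local section there. -/
theorem exists_contMDiffAt_section [I.Boundaryless] [IsManifold I ∞ M]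
    [I'.Boundaryless] [FiniteDimensional ℝ E'] [CompleteSpace E'] [IsManifold I' ∞ M']
    {f : M → M'} {x : M} (hf : ContMDiffAt I I' ∞ f x)
    (hs : Function.Surjective (mfderiv I I' f x)) :
    ∃ s : M' → M, s (f x) = x ∧ ContMDiffAt I' I ∞ s (f x) ∧ ∀ᶠ y in 𝓝 (f x), f (s y) = y := by
  set F : E → E' := writtenInExtChartAt I I' x f with hF
  have hFs : ContDiffAt ℝ ∞ F (extChartAt I x x) := by
    have := (contMDiffAt_iff.1 hf).2
    rwa [I.range_eq_univ, contDiffWithinAt_univ] at this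
  have hFx : F (extChartAt I x x) = extChartAt I' (f x) (f x) := by
    simp only [hF, writtenInExtChartAt, Function.comp_apply, extChartAt_to_inv]
  have hFd : Function.Surjective (fderiv ℝ F (extChartAt I x x)) := by
    rw [(hf.mdifferentiableAt (by simp)).mfderiv, I.range_eq_univ, fderivWithin_univ] at hs
    exact hs
  obtain ⟨s, hs0, hss, hsr⟩ := exists_contDiffAt_right_inverse hFs hFd
  rw [hFx] at hs0 hss hsr
  have hc : ContMDiffAt I' 𝓘(ℝ, E) ∞ (fun y => s (extChartAt I' (f x) y)) (f x) :=
    (hss.contMDiffAt).comp (f x) contMDiffAt_extChartAt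
  have hsymm : ContMDiffAt 𝓘(ℝ, E) I ∞ (extChartAt I x).symm (extChartAt I x x) := by
    have := contMDiffWithinAt_extChartAt_symm_range (n := ∞) x (mem_extChartAt_target (I := I) x)
    rwa [I.range_eq_univ, contMDiffWithinAt_univ] at this
  have hsx : (fun y => s (extChartAt I' (f x) y)) (f x) = extChartAt I x x := hs0
  have hσ : ContMDiffAt I' I ∞ (fun y => (extChartAt I x).symm (s (extChartAt I' (f x) y)))
      (f x) := by
    rw [← hsx] at hsymm
    exact hsymm.comp (f x) hc
  have hσx : (extChartAt I x).symm (s (extChartAt I' (f x) (f x))) = x := by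
    rw [hs0, extChartAt_to_inv]
  refine ⟨fun y => (extChartAt I x).symm (s (extChartAt I' (f x) y)), hσx, hσ, ?_⟩
  have e1 : ∀ᶠ y in 𝓝 (f x), F (s (extChartAt I' (f x) y)) = extChartAt I' (f x) y :=
    (continuousAt_extChartAt (I := I') (f x)).eventually hsr
  have e2 : ∀ᶠ y in 𝓝 (f x),
      f ((extChartAt I x).symm (s (extChartAt I' (f x) y))) ∈ (extChartAt I' (f x)).source := by
    refine (hf.continuousAt.comp_of_eq hσ.continuousAt hσx).eventually_mem ?_
    simp only [Function.comp_apply, hσx]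
    exact extChartAt_source_mem_nhds (I := I') (f x)
  filter_upwards [e1, e2, extChartAt_source_mem_nhds (I := I') (f x)] with y h1 h2 h3
  exact (extChartAt I' (f x)).injOn h2 h3 h1

/-- Local integral curves of a smooth vector field. -/
theorem exists_integral_curve [I.Boundaryless] [CompleteSpace E] [IsManifold I ∞ M]
    {V : (x : M) → TangentSpace I x} (x : M)
    (hV : ContMDiff I I.tangent ∞ (fun y => (⟨y, V y⟩ : TangentBundle I M))) :
    ∃ ε > 0, ∃ c : ℝ → M, c 0 = x ∧ ∀ t ∈ Ioo (-ε) ε,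
      HasMFDerivAt 𝓘(ℝ, ℝ) I c t ((1 : ℝ →L[ℝ] ℝ).smulRight (V (c t))) := by
  obtain ⟨c, hc0, hc⟩ := exists_isMIntegralCurveAt_of_contMDiffAt_boundaryless 0
    ((hV x).of_le (by simp))
  obtain ⟨ε, hε, h⟩ := Metric.eventually_nhds_iff_ball.1 hc
  refine ⟨ε, hε, c, hc0, fun t ht => h t ?_⟩
  simpa [Real.ball_eq_Ioo] using ht

/-- A curve with vanishing derivative is constant. -/
theorem eq_of_hasMFDerivAt_zero [I.Boundaryless] [CompleteSpace E] [IsManifold I ∞ M] [T2Space M]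
    {c : ℝ → M} {ε : ℝ} (hc : ∀ t ∈ Ioo (-ε) ε, HasMFDerivAt 𝓘(ℝ, ℝ) I c t 0) {t : ℝ}
    (ht : t ∈ Ioo (-ε) ε) : c t = c 0 := by
  have h0 : (0 : ℝ) ∈ Ioo (-ε) ε := by
    rcases ht with ⟨h1, h2⟩
    constructor <;> linarith
  have hz : ∀ p : M, ((1 : ℝ →L[ℝ] ℝ).smulRight (0 : TangentSpace I p)) = 0 := by
    intro p; ext; simp
  exact isMIntegralCurveOn_Ioo_eqOn_of_contMDiff_boundaryless (I := I) (γ := c)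
    (γ' := fun _ => c 0) (v := fun _ => 0) h0
    ((contMDiff_zeroSection ℝ (TangentSpace I : M → Type _)))
    (fun t ht => by rw [hz]; exact (hc t ht).hasMFDerivWithinAt)
    (fun t ht => by rw [hz]; exact (hasMFDerivAt_const (c 0) t).hasMFDerivWithinAt) rfl ht

end SectionsAndCurves

/-! ### Lie groups in left trivialisation -/

section LieGroup

theorem tangentBundle_mk_eq {E : Type*} [NormedAddCommGroup E] [NormedSpace ℝ E]
    {EH : Type*} [TopologicalSpace EH] {I : ModelWithCorners ℝ E EH} {M : Type*}
    [TopologicalSpace M] [ChartedSpace EH M] {p q : M} (h : p = q) {v w : E} (hv : v = w) :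
    (⟨p, v⟩ : TangentBundle I M) = ⟨q, w⟩ := by
  subst h; subst hv; rfl

variable {n : ℕ} {G : Type*} [TopologicalSpace G] [Group G] [ChartedSpace (Model n) G]

/-- The differential at `1` of left translation by `g`, on the model space underlying the Lie
algebra. Its value at `x` is that of the left-invariant vector field of `x`. -/
def leftVec (g : G) : Model n →L[ℝ] TangentSpace (𝓡 n) g :=
  mfderiv (𝓡 n) (𝓡 n) (fun z : G => g * z) (1 : G)

/-- The adjoint representation, on the model space underlying the Lie algebra. -/
def adM (g : G) : Model n →L[ℝ] Model n := Ad n g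

/-- The function `g ↦ Ad(g⁻¹) y`. In the left trivialisation of the tangent bundle, it represents
the right-invariant vector field of `y`. -/
def adInv (y : Model n) (g : G) : Model n := adM g⁻¹ y

/-- The derivative of `f` along the left-invariant vector field of `x`. -/
def leftDeriv {F : Type*} [NormedAddCommGroup F] [NormedSpace ℝ F] (x : Model n) (f : G → F)
    (g : G) : F :=
  mvfderiv (𝓡 n) f g (leftVec g x)

theorem leftVec_one (x : Model n) : leftVec (1 : G) x = x := by
  have h : ∀ f : G → G, f = id → mfderiv (𝓡 n) (𝓡 n) f (1 : G) x = x := by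
    rintro f rfl; rw [mfderiv_id]; rfl
  exact h _ (by ext; simp)

theorem adM_one (x : Model n) : adM (1 : G) x = x := by
  have h : ∀ f : G → G, f = id → mfderiv (𝓡 n) (𝓡 n) f (1 : G) x = x := by
    rintro f rfl; rw [mfderiv_id]; rfl
  exact h _ (by ext; simp)

variable [LieGroup (𝓡 n) ∞ G]

/-- The Lie bracket of the Lie algebra of `G`, on the underlying model space. -/
def lieB (G : Type*) [TopologicalSpace G] [Group G] [ChartedSpace (Model n) G]
    [LieGroup (𝓡 n) ∞ G] : Model n →ₗ[ℝ] Model n →ₗ[ℝ] Model n :=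
  LinearMap.mk₂ ℝ
    (fun x y => @Bracket.bracket (GroupLieAlgebra (𝓡 n) G) (GroupLieAlgebra (𝓡 n) G) _ x y)
    (fun x x' y => add_lie (L := GroupLieAlgebra (𝓡 n) G) (M := GroupLieAlgebra (𝓡 n) G) x x' y)
    (fun c x y => smul_lie (L := GroupLieAlgebra (𝓡 n) G) (M := GroupLieAlgebra (𝓡 n) G) c x y)
    (fun x y y' => lie_add (L := GroupLieAlgebra (𝓡 n) G) (M := GroupLieAlgebra (𝓡 n) G) x y y')
    (fun c x y => lie_smul (L := GroupLieAlgebra (𝓡 n) G) (M := GroupLieAlgebra (𝓡 n) G) c x y)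

theorem lieB_skew (x y : Model n) : lieB G x y = -lieB G y x :=
  (lie_skew (L := GroupLieAlgebra (𝓡 n) G) x y).symm

theorem lieB_self (x : Model n) : lieB G x x = 0 :=
  lie_self (L := GroupLieAlgebra (𝓡 n) G) x

theorem lieB_lieB (x y z : Model n) :
    lieB G x (lieB G y z) = lieB G (lieB G x y) z + lieB G y (lieB G x z) :=
  leibniz_lie (L₁ := GroupLieAlgebra (𝓡 n) G) (L₂ := GroupLieAlgebra (𝓡 n) G)
    (M := GroupLieAlgebra (𝓡 n) G) x y z

theorem mdifferentiable_mul_left' (g : G) : MDifferentiable (𝓡 n) (𝓡 n) (fun x : G => g * x) :=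
  (contMDiff_mul_left (I := 𝓡 n) (n := ∞)).mdifferentiable (by simp)

theorem mdifferentiable_mul_right' (g : G) : MDifferentiable (𝓡 n) (𝓡 n) (fun x : G => x * g) :=
  (contMDiff_mul_right (I := 𝓡 n) (n := ∞)).mdifferentiable (by simp)

theorem mdifferentiable_conj (g : G) :
    MDifferentiable (𝓡 n) (𝓡 n) (fun x : G => g * x * g⁻¹) := fun x =>
  (mdifferentiable_mul_right' g⁻¹ _).comp x (mdifferentiable_mul_left' g x)

/-- Left translation preserves left-invariant fields. -/
theorem mfderiv_mul_left_leftVec (b g : G) (x : Model n) :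
    mfderiv (𝓡 n) (𝓡 n) (fun z => b * z) g (leftVec g x) = leftVec (b * g) x := by
  have h := mfderiv_comp_apply_of_eq (I := 𝓡 n) (I' := 𝓡 n) (I'' := 𝓡 n) (1 : G)
    (mdifferentiable_mul_left' b g) (mdifferentiable_mul_left' g 1) (mul_one g) x
  have h2 : (fun z => b * z) ∘ (fun z : G => g * z) = fun z => b * g * z := by
    ext z; simp [mul_assoc]
  rw [h2] at h
  exact h.symm

theorem leftVec_injective (g : G) : Function.Injective (leftVec g : Model n → _) := by
  intro x y h
  have h1 := mfderiv_mul_left_leftVec g⁻¹ g x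
  have h2 := mfderiv_mul_left_leftVec g⁻¹ g y
  rw [h, h2] at h1
  have h3 : ∀ a : G, a = 1 → leftVec a y = leftVec a x → x = y := by
    rintro a rfl h
    rw [leftVec_one, leftVec_one] at h
    exact h.symm
  exact h3 _ (inv_mul_cancel g) h1

/-- The right translate of the left-invariant field of `x` by `h` is the left-invariant field of
`Ad(h⁻¹) x`. -/
theorem mfderiv_mul_right_leftVec (g h : G) (x : Model n) :
    mfderiv (𝓡 n) (𝓡 n) (fun z => z * h) g (leftVec g x) = leftVec (g * h) (adM h⁻¹ x) := by
  have h1 := mfderiv_comp_apply_of_eq (I := 𝓡 n) (I' := 𝓡 n) (I'' := 𝓡 n) (1 : G)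
    (mdifferentiable_mul_right' h g) (mdifferentiable_mul_left' g 1) (mul_one g) x
  have h2 := mfderiv_comp_apply_of_eq (I := 𝓡 n) (I' := 𝓡 n) (I'' := 𝓡 n) (1 : G)
    (mdifferentiable_mul_left' (g * h) 1) (mdifferentiable_conj h⁻¹ 1) (by simp) x
  have h3 : (fun z => z * h) ∘ (fun z : G => g * z) =
      (fun z => g * h * z) ∘ (fun z => h⁻¹ * z * h⁻¹⁻¹) := by
    ext z; simp [mul_assoc]
  rw [h3] at h1
  exact h1.symm.trans h2

theorem contMDiff_leftVec {a : G → Model n} (ha : ContMDiff (𝓡 n) 𝓘(ℝ, Model n) ∞ a) :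
    ContMDiff (𝓡 n) (𝓡 n).tangent ∞
      (fun g : G => (⟨g, leftVec g (a g)⟩ : TangentBundle (𝓡 n) G)) := by
  intro g
  have h := contMDiffAt_mfderiv_prod (contMDiff_mul (𝓡 n) ∞ (G := G))
    (a := fun q : G => (⟨q, 0⟩ : TangentBundle (𝓡 n) G))
    (b := fun q : G => (⟨1, a q⟩ : TangentBundle (𝓡 n) G)) (q := g) (K := 𝓡 n)
    (contMDiff_zeroSection ℝ (TangentSpace (𝓡 n) : G → Type _) g)
    ((contMDiffAt_tangent_const_iff (1 : G)).2 (ha g))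
  refine h.congr_of_eventuallyEq (Filter.Eventually.of_forall fun q => ?_)
  refine tangentBundle_mk_eq (mul_one q).symm ?_
  have h0 := map_zero (mfderiv (𝓡 n) (𝓡 n) (fun z : G => z * 1) q)
  exact ((congrArg (fun w : Model n => w + (show Model n from leftVec q (a q))) h0).trans
    (zero_add _)).symm

theorem mdifferentiableAt_leftVec {a : G → Model n} (ha : ContMDiff (𝓡 n) 𝓘(ℝ, Model n) ∞ a)
    (g : G) : MDifferentiableAt (𝓡 n) (𝓡 n).tangent
      (fun g : G => (⟨g, leftVec g (a g)⟩ : TangentBundle (𝓡 n) G)) g :=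
  (contMDiff_leftVec ha g).mdifferentiableAt (by simp)

theorem mdifferentiableAt_leftVec_const (x : Model n) (g : G) :
    MDifferentiableAt (𝓡 n) (𝓡 n).tangent
      (fun g : G => (⟨g, leftVec g x⟩ : TangentBundle (𝓡 n) G)) g :=
  mdifferentiableAt_leftVec contMDiff_const g

theorem contMDiff_adInv (y : Model n) :
    ContMDiff (𝓡 n) 𝓘(ℝ, Model n) ∞ (adInv y : G → Model n) := by
  intro g
  have hΦ : ContMDiff ((𝓡 n).prod (𝓡 n)) (𝓡 n) ∞ (fun p : G × G => p.1⁻¹ * p.2 * p.1⁻¹⁻¹) :=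
    ((contMDiff_fst.inv).mul contMDiff_snd).mul contMDiff_fst.inv.inv
  have h := contMDiffAt_mfderiv_prod hΦ
    (a := fun q : G => (⟨q, 0⟩ : TangentBundle (𝓡 n) G))
    (b := fun q : G => (⟨1, y⟩ : TangentBundle (𝓡 n) G)) (q := g) (K := 𝓡 n)
    (contMDiff_zeroSection ℝ (TangentSpace (𝓡 n) : G → Type _) g)
    contMDiffAt_const
  rw [← contMDiffAt_tangent_const_iff (I := 𝓡 n) (1 : G)]
  refine h.congr_of_eventuallyEq (Filter.Eventually.of_forall fun q => ?_)
  refine tangentBundle_mk_eq (by simp) ?_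
  have h0 := map_zero (mfderiv (𝓡 n) (𝓡 n) (fun z : G => z⁻¹ * 1 * z⁻¹⁻¹) q)
  exact ((congrArg (fun w : Model n => w + adInv y q) h0).trans (zero_add _)).symm

theorem adM_mul (g h : G) (x : Model n) : adM (g * h) x = adM g (adM h x) := by
  have h1 := mfderiv_comp_apply_of_eq (I := 𝓡 n) (I' := 𝓡 n) (I'' := 𝓡 n) (1 : G)
    (mdifferentiable_conj g 1) (mdifferentiable_conj h 1) (by simp) x
  have h3 : (fun z => g * z * g⁻¹) ∘ (fun z : G => h * z * h⁻¹) =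
      (fun z => (g * h) * z * (g * h)⁻¹) := by
    ext z; simp [mul_assoc]
  rw [h3] at h1
  exact h1

theorem adM_inv_adM (g : G) (x : Model n) : adM g⁻¹ (adM g x) = x := by
  rw [← adM_mul, inv_mul_cancel, adM_one]

theorem adM_adM_inv (g : G) (x : Model n) : adM g (adM g⁻¹ x) = x := by
  rw [← adM_mul, mul_inv_cancel, adM_one]

theorem adInv_mul (y : Model n) (g h : G) : adInv y (g * h) = adInv (adInv y g) h := by
  simp only [adInv, mul_inv_rev, adM_mul]

/-- `Ad g` is an automorphism of the Lie algebra: conjugation by `g` relates the left-invariant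
fields of `x` and of `Ad(g) x`. -/
theorem adM_lieB (g : G) (x y : Model n) :
    adM g (lieB G x y) = lieB G (adM g x) (adM g y) := by
  have hc : ContMDiff (𝓡 n) (𝓡 n) ∞ (fun x : G => g * x * g⁻¹) :=
    (contMDiff_const.mul contMDiff_id).mul contMDiff_const
  have hrel : ∀ (x : Model n) (h : G),
      mfderiv (𝓡 n) (𝓡 n) (fun x : G => g * x * g⁻¹) h (leftVec h x) =
        leftVec (g * h * g⁻¹) (adM g x) := by
    intro x h
    have h1 := mfderiv_comp_apply_of_eq (I := 𝓡 n) (I' := 𝓡 n) (I'' := 𝓡 n) (1 : G)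
      (mdifferentiable_conj g h) (mdifferentiable_mul_left' h 1) (mul_one h) x
    have h2 := mfderiv_comp_apply_of_eq (I := 𝓡 n) (I' := 𝓡 n) (I'' := 𝓡 n) (1 : G)
      (mdifferentiable_mul_left' (g * h * g⁻¹) 1) (mdifferentiable_conj g 1) (by simp) x
    have h3 : (fun z => g * z * g⁻¹) ∘ (fun z : G => h * z) =
        (fun z => g * h * g⁻¹ * z) ∘ (fun z => g * z * g⁻¹) := by
      ext z; simp [mul_assoc]
    rw [h3] at h1
    exact h1.symm.trans h2
  have h := mfderiv_mlieBracket_of_related (V' := fun h => leftVec h (adM g x))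
    (W' := fun h => leftVec h (adM g y)) (hc (1 : G))
    (mdifferentiableAt_leftVec_const x 1) (mdifferentiableAt_leftVec_const y 1)
    (mdifferentiableAt_leftVec_const (adM g x) _) (mdifferentiableAt_leftVec_const (adM g y) _)
    (hrel x) (hrel y)
  have h4 : ∀ a : G, a = 1 → ∀ w : Model n, w = mlieBracket (𝓡 n)
      (fun h : G => leftVec h (adM g x)) (fun h => leftVec h (adM g y)) a →
      w = lieB G (adM g x) (adM g y) := by
    rintro a rfl w hw; exact hw
  exact h4 _ (by simp) _ h

/-- Left-invariant and right-invariant vector fields commute. -/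
theorem mlieBracket_right_left (x y : Model n) (g : G) :
    mlieBracket (𝓡 n) (fun g : G => leftVec g (adInv y g)) (fun g => leftVec g x) g = 0 := by
  have hR := contMDiff_leftVec (contMDiff_adInv (G := G) y)
  have key := mlieBracket_eq_zero_of_related_prod hR
    (contMDiff_leftVec (G := G) (a := fun _ => x) contMDiff_const)
    (contMDiff_mul (𝓡 n) ∞ (G := G)) (1, g) ((hR _).mdifferentiableAt (by simp))
    (mdifferentiableAt_leftVec_const x _) (fun a b => ?_) (fun a b => ?_)
  · have h4 : ∀ a : G, a = g →
      mlieBracket (𝓡 n) (fun g : G => leftVec g (adInv y g)) (fun g => leftVec g x) a = 0 →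
      mlieBracket (𝓡 n) (fun g : G => leftVec g (adInv y g)) (fun g => leftVec g x) g = 0 := by
      rintro a rfl h; exact h
    exact h4 _ (one_mul g) key
  · have h := mfderiv_mul_right_leftVec a b (adInv y a)
    rw [← adInv, ← adInv_mul] at h
    exact h
  · exact mfderiv_mul_left_leftVec a b x

/-- The bracket with a field which is expanded in left-invariant fields. -/
theorem mlieBracket_leftVec_sum {ι : Type*} (s : Finset ι) (e : ι → Model n)
    (b : ι → G → ℝ) (hb : ∀ i, ContMDiff (𝓡 n) 𝓘(ℝ, ℝ) ∞ (b i))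
    (V : (g : G) → TangentSpace (𝓡 n) g) (g : G) :
    mlieBracket (𝓡 n) V (fun g => leftVec g (∑ i ∈ s, b i g • e i)) g =
      ∑ i ∈ s, (mvfderiv (𝓡 n) (b i) g (V g) • leftVec g (e i)
        + b i g • mlieBracket (𝓡 n) V (fun g => leftVec g (e i)) g) := by
  classical
  induction s using Finset.induction_on with
  | empty =>
    have h : (fun g : G => leftVec g (∑ i ∈ (∅ : Finset ι), b i g • e i)) = 0 := by
      funext g; rw [Finset.sum_empty]; exact map_zero _
    rw [h, mlieBracket_zero_right, Finset.sum_empty]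
    rfl
  | insert j s hj ih =>
    have h : (fun g : G => leftVec g (∑ i ∈ insert j s, b i g • e i)) =
        (b j • fun g => leftVec g (e j)) + fun g => leftVec g (∑ i ∈ s, b i g • e i) := by
      funext g
      rw [Finset.sum_insert hj, map_add, map_smul]
      rfl
    have hs : ContMDiff (𝓡 n) 𝓘(ℝ, Model n) ∞ (fun g => ∑ i ∈ s, b i g • e i) :=
      contMDiff_finsetSum fun i _ => (hb i).smul contMDiff_const
    have hj' : ContMDiff (𝓡 n) 𝓘(ℝ, Model n) ∞ (fun g => b j g • e j) :=
      (hb j).smul contMDiff_const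
    have hjs := mdifferentiableAt_leftVec hj' g
    have hjeq : (fun g : G => (⟨g, leftVec g (b j g • e j)⟩ :
        TangentBundle (𝓡 n) G)) = fun g => ⟨g, (b j • fun g => leftVec g (e j)) g⟩ := by
      funext g; rw [map_smul]; rfl
    rw [h, mlieBracket_add_right (hjeq ▸ hjs) (mdifferentiableAt_leftVec hs g),
      mlieBracket_smul_right ((hb j g).mdifferentiableAt (by simp))
        (mdifferentiableAt_leftVec_const _ _), ih, Finset.sum_insert hj]

/-- The bracket of an arbitrary field with a field in left trivialisation. -/
theorem mlieBracket_leftVec_right {b : G → Model n} (hb : ContMDiff (𝓡 n) 𝓘(ℝ, Model n) ∞ b)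
    (V : (g : G) → TangentSpace (𝓡 n) g) (g : G) :
    mlieBracket (𝓡 n) V (fun g => leftVec g (b g)) g =
      leftVec g (mvfderiv (𝓡 n) b g (V g)) + mlieBracket (𝓡 n) V (fun h => leftVec h (b g)) g := by
  set e : Fin n → Model n := fun i => EuclideanSpace.basisFun (Fin n) ℝ i with he
  have hsum : ∀ v : Model n, v = ∑ i, v i • e i := fun v =>
    ((EuclideanSpace.basisFun (Fin n) ℝ).sum_repr v).symm
  have hbi : ∀ i, ContMDiff (𝓡 n) 𝓘(ℝ, ℝ) ∞ (fun g => b g i) := fun i =>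
    ((EuclideanSpace.proj (𝕜 := ℝ) i : Model n →L[ℝ] ℝ).contMDiff).comp hb
  have hder : ∀ i, mvfderiv (𝓡 n) (fun g => b g i) g (V g) = mvfderiv (𝓡 n) b g (V g) i :=
    fun i => mvfderiv_clm_comp (EuclideanSpace.proj (𝕜 := ℝ) i : Model n →L[ℝ] ℝ)
      ((hb g).mdifferentiableAt (by simp)) (V g)
  have h1 := mlieBracket_leftVec_sum Finset.univ e (fun i g => b g i) hbi V g
  have h2 := mlieBracket_leftVec_sum Finset.univ e (fun i _ => b g i)
    (fun i => contMDiff_const) V g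
  have e1 : (fun h : G => leftVec h (∑ i, b h i • e i)) = fun h => leftVec h (b h) := by
    funext h; rw [← hsum]
  have e2 : (fun h : G => leftVec h (∑ i, b g i • e i)) = fun h => leftVec h (b g) := by
    funext h; rw [← hsum]
  rw [e1] at h1
  rw [e2] at h2
  rw [h1, h2, hsum (mvfderiv (𝓡 n) b g (V g)), map_sum, ← Finset.sum_add_distrib]
  refine Finset.sum_congr rfl fun i _ => ?_
  rw [hder, mvfderiv_const, map_smul, zero_apply, zero_smul, zero_add]

/-- The bracket of two vector fields in left trivialisation. -/
theorem mlieBracket_leftVec {a b : G → Model n} (ha : ContMDiff (𝓡 n) 𝓘(ℝ, Model n) ∞ a)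
    (hb : ContMDiff (𝓡 n) 𝓘(ℝ, Model n) ∞ b) (g : G) :
    mlieBracket (𝓡 n) (fun g => leftVec g (a g)) (fun g => leftVec g (b g)) g =
      leftVec g (leftDeriv (a g) b g - leftDeriv (b g) a g + lieB G (a g) (b g)) := by
  have h : ∀ x y : Model n, mlieBracket (𝓡 n) (fun g : G => leftVec g x) (fun g => leftVec g y) g =
      leftVec g (lieB G x y) := fun x y =>
    (congrFun (mulInvariantVector_mlieBracket (I := 𝓡 n) (x : GroupLieAlgebra (𝓡 n) G)
      (y : GroupLieAlgebra (𝓡 n) G)) g).symm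
  rw [mlieBracket_leftVec_right hb, mlieBracket_swap_apply, mlieBracket_leftVec_right ha, h,
    lieB_skew (a g), map_add, map_sub, map_neg, neg_add, ← add_assoc, ← sub_eq_add_neg]
  rfl

/-- The infinitesimal form of `g ↦ Ad(g⁻¹)`. The commutation of the left-invariant field of `x` with
the right-invariant field of `y` gives it without recourse to the exponential map. -/
theorem leftDeriv_adInv (x y : Model n) (g : G) :
    leftDeriv x (adInv y) g = -lieB G x (adInv y g) := by
  have h := mlieBracket_right_left x y g
  rw [mlieBracket_leftVec (a := adInv y) (b := fun _ => x) (contMDiff_adInv y) contMDiff_const]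
    at h
  have h2 := leftVec_injective g (h.trans (map_zero _).symm)
  have h3 : leftDeriv (adInv y g) (fun _ : G => x) g = 0 := by
    rw [leftDeriv, mvfderiv_const]; rfl
  rw [h3, zero_sub, lieB_skew] at h2
  rw [← neg_eq_iff_eq_neg]
  exact add_neg_eq_zero.1 h2

end LieGroup

/-! ### The projection to the homogeneous space -/

section HomogeneousSpace

variable {n k : ℕ} {G : Type*} [TopologicalSpace G] [Group G] [ChartedSpace (Model n) G]
  {H : Subgroup G}

theorem smul_mk (g a : G) : g • (QuotientGroup.mk a : G ⧸ H) = QuotientGroup.mk (g * a) := rfl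

variable [ChartedSpace (Model k) (G ⧸ H)]

/-- The differential of the translation by `g`, as an endomorphism of the model space. -/
def dtransM (g : G) (p : G ⧸ H) : Model k →L[ℝ] Model k := dtrans k g p

variable (n k H) in
/-- The differential at `1` of the projection `G → G ⧸ H`, as a map of the model spaces. -/
def dprojM : Model n →L[ℝ] Model k := dproj n k H

variable [hs : IsHomogeneousSpace n k H]

include hs in
variable (n k H) in
theorem contMDiff_action :
    ContMDiff ((𝓡 n).prod (𝓡 k)) (𝓡 k) ∞ (fun p : G × (G ⧸ H) => p.1 • p.2) :=
  hs.smooth_smul.contMDiff_smul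

include hs in
theorem mdifferentiable_smul (g : G) :
    MDifferentiable (𝓡 k) (𝓡 k) (fun q : G ⧸ H => g • q) :=
  ((contMDiff_action n k H).comp (contMDiff_const.prodMk contMDiff_id)).mdifferentiable (by simp)

include hs in
theorem contMDiff_mk : ContMDiff (𝓡 n) (𝓡 k) ∞ (QuotientGroup.mk : G → G ⧸ H) := by
  have h : (QuotientGroup.mk : G → G ⧸ H) = fun g => g • origin H := by
    funext g
    exact (congrArg QuotientGroup.mk (mul_one g)).symm
  rw [h]
  exact (contMDiff_action n k H).comp (contMDiff_id.prodMk contMDiff_const)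

include hs in
theorem mdifferentiable_mk : MDifferentiable (𝓡 n) (𝓡 k) (QuotientGroup.mk : G → G ⧸ H) :=
  contMDiff_mk.mdifferentiable (by simp)

include hs in
theorem dtransM_comp (g g' : G) {p p' : G ⧸ H} (h : g' • p = p') (v : Model k) :
    dtransM g p' (dtransM g' p v) = dtransM (g * g') p v := by
  have h1 := mfderiv_comp_apply_of_eq (I := 𝓡 k) (I' := 𝓡 k) (I'' := 𝓡 k) p
    (mdifferentiable_smul (n := n) g p') (mdifferentiable_smul (n := n) g' p) h v
  have h2 : (fun q : G ⧸ H => g • q) ∘ (fun q => g' • q) = fun q => (g * g') • q := by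
    ext q; simp [mul_smul]
  rw [h2] at h1
  exact h1.symm

theorem dtransM_one (p : G ⧸ H) (v : Model k) : dtransM 1 p v = v := by
  have h : ∀ f : G ⧸ H → G ⧸ H, f = id → mfderiv (𝓡 k) (𝓡 k) f p v = v := by
    rintro f rfl; rw [mfderiv_id]; rfl
  exact h _ (by ext; simp)

include hs in
theorem dtransM_inv_dtransM (g : G) {p p' : G ⧸ H} (h : g • p = p') (v : Model k) :
    dtransM g⁻¹ p' (dtransM g p v) = v := by
  rw [dtransM_comp (n := n) _ _ h, inv_mul_cancel, dtransM_one]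

include hs in
theorem dtransM_dtransM_inv (g : G) {p p' : G ⧸ H} (h : g • p = p') (v : Model k) :
    dtransM g p (dtransM g⁻¹ p' v) = v := by
  rw [dtransM_comp (n := n) _ _ (by rw [← h, inv_smul_smul]), mul_inv_cancel, dtransM_one]

variable [LieGroup (𝓡 n) ∞ G]

include hs in
/-- The differential of the projection, in left trivialisation. -/
theorem mfderiv_mk_leftVec (g : G) (x : Model n) :
    mfderiv (𝓡 n) (𝓡 k) (QuotientGroup.mk : G → G ⧸ H) g (leftVec g x) =
      dtransM g (origin H) (dprojM n k H x) := by
  have h1 := mfderiv_comp_apply_of_eq (I := 𝓡 n) (I' := 𝓡 n) (I'' := 𝓡 k) (1 : G)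
    (mdifferentiable_mk (k := k) (H := H) g) (mdifferentiable_mul_left' g 1) (mul_one g) x
  have h2 := mfderiv_comp_apply (I := 𝓡 n) (I' := 𝓡 k) (I'' := 𝓡 k) (1 : G)
    (mdifferentiable_smul (n := n) g (QuotientGroup.mk (1 : G) : G ⧸ H)) (mdifferentiable_mk 1) x
  exact h1.symm.trans h2

include hs in
/-- The identification of `𝔤 ⧸ 𝔥` with the tangent space at the base point is `H`-equivariant. -/
theorem dtransM_dprojM {h : G} (hh : h ∈ H) (x : Model n) :
    dtransM h (origin H) (dprojM n k H x) = dprojM n k H (adM h x) := by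
  have h1 := mfderiv_comp_apply_of_eq (I := 𝓡 n) (I' := 𝓡 n) (I'' := 𝓡 k) (1 : G)
    (mdifferentiable_mk (k := k) (H := H) 1) (mdifferentiable_conj h 1) (by simp) x
  have h2 := mfderiv_comp_apply (I := 𝓡 n) (I' := 𝓡 k) (I'' := 𝓡 k) (1 : G)
    (mdifferentiable_smul (n := n) h (QuotientGroup.mk (1 : G) : G ⧸ H)) (mdifferentiable_mk 1) x
  have h3 : (QuotientGroup.mk : G → G ⧸ H) ∘ (fun x => h * x * h⁻¹) =
      (fun q : G ⧸ H => h • q) ∘ QuotientGroup.mk := by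
    ext x
    simp only [Function.comp_apply, smul_mk]
    rw [QuotientGroup.eq]
    simpa [mul_assoc] using hh
  rw [h3] at h1
  exact h2.symm.trans h1

/-- A field on `G ⧸ H` defined by an `Ad(H)`-equivariant function on `G` does not depend on the
choice of representatives. -/
theorem dtransM_dprojM_eq {N : G → Model n} (hN : ∀ g, ∀ h ∈ H, N (g * h) = adM h⁻¹ (N g))
    {g g' : G} (h : (QuotientGroup.mk g : G ⧸ H) = QuotientGroup.mk g') :
    dtransM g (origin H) (dprojM n k H (N g)) = dtransM g' (origin H) (dprojM n k H (N g')) := by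
  obtain ⟨a, ha, rfl⟩ : ∃ a ∈ H, g' = g * a := ⟨g⁻¹ * g', QuotientGroup.eq.1 h, by simp⟩
  rw [hN g a ha, ← dtransM_dprojM (inv_mem ha), dtransM_comp (n := n)]
  · simp
  · rw [smul_mk, QuotientGroup.eq]; simpa using ha

/-- A vector field on `G ⧸ H` is smooth if its horizontal lift to `G` is given by a smooth
function. -/
theorem isSmoothField_of_lift [IsManifold (𝓡 k) ∞ (G ⧸ H)] {N : G → Model n}
    (hs' : ContMDiff (𝓡 n) 𝓘(ℝ, Model n) ∞ N)
    {X : VField k H} (hX : ∀ g : G, X (QuotientGroup.mk g) =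
      dtransM g (origin H) (dprojM n k H (N g))) : IsSmoothField X := by
  intro p
  obtain ⟨g, rfl⟩ := QuotientGroup.mk_surjective p
  have hsub : Function.Surjective (mfderiv (𝓡 n) (𝓡 k) (QuotientGroup.mk : G → G ⧸ H) g) := by
    intro v
    obtain ⟨x, hx⟩ := hs.submersion (dtransM g⁻¹ (QuotientGroup.mk g : G ⧸ H) v)
    refine ⟨leftVec g x, (mfderiv_mk_leftVec g x).trans ?_⟩
    have : dprojM n k H x = dtransM g⁻¹ (QuotientGroup.mk g : G ⧸ H) v := hx
    rw [this]
    exact dtransM_dtransM_inv (n := n) g (by rw [smul_mk, mul_one]) v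
  obtain ⟨s, hs0, hss, hsr⟩ := exists_contMDiffAt_section (contMDiff_mk (k := k) (H := H) g) hsub
  have h := contMDiffAt_mfderiv_prod (contMDiff_action n k H)
    (a := fun q : G ⧸ H => (⟨s q, 0⟩ : TangentBundle (𝓡 n) G))
    (b := fun q : G ⧸ H => (⟨origin H, dprojM n k H (N (s q))⟩ : TangentBundle (𝓡 k) (G ⧸ H)))
    (q := (QuotientGroup.mk g : G ⧸ H)) (K := 𝓡 k)
    ((contMDiff_zeroSection ℝ (TangentSpace (𝓡 n) : G → Type _) _).comp _ hss)
    ((contMDiffAt_tangent_const_iff (origin H)).2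
      ((dprojM n k H).contMDiff.contMDiffAt.comp _ ((hs' _).comp _ hss)))
  refine h.congr_of_eventuallyEq ?_
  filter_upwards [hsr] with q hq
  refine tangentBundle_mk_eq (p := q) ?_ ?_
  · rw [smul_mk, mul_one, hq]
  · have h0 := map_zero (mfderiv (𝓡 n) (𝓡 k) (fun z : G => z • origin H) (s q))
    have h1 := hX (s q)
    rw [hq] at h1
    exact h1.trans ((congrArg (fun w : Model k =>
      w + dtransM (s q) (origin H) (dprojM n k H (N (s q)))) h0).trans (zero_add _)).symm

end HomogeneousSpace

/-! ### Vector fields on a reductive homogeneous space as functions on the group -/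

section Reductive

variable {n k : ℕ} {G : Type*} [TopologicalSpace G] [Group G] [ChartedSpace (Model n) G]
  {H : Subgroup G} [ChartedSpace (Model k) (G ⧸ H)]

namespace ReductiveDecomposition

variable (D : ReductiveDecomposition n k H)

/-- The complement `𝔪`, as a subspace of the model space. -/
def mM : Submodule ℝ (Model n) := D.m

/-- The projection `x ↦ x_𝔪`, as an endomorphism of the model space. -/
def prM : Model n →L[ℝ] Model n :=
  LinearMap.toContinuousLinearMap
    (show Model n →ₗ[ℝ] Model n from D.m.subtype ∘ₗ D.projM)

theorem prM_mem (x : Model n) : D.prM x ∈ D.mM := (D.projM x).2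

theorem prM_of_mem {x : Model n} (hx : x ∈ D.mM) : D.prM x = x :=
  congrArg Subtype.val (Submodule.projectionOnto_apply_left D.isCompl.symm ⟨x, hx⟩)

theorem prM_eq_zero_iff {x : Model n} : D.prM x = 0 ↔ dprojM n k H x = 0 := by
  have h : D.projM x = 0 ↔ x ∈ isotropyAlgebra n k H :=
    Submodule.projectionOnto_apply_eq_zero_iff D.isCompl.symm
  refine Iff.trans ?_ h
  exact ⟨fun h => Subtype.ext h, fun h => congrArg Subtype.val h⟩

theorem dprojM_prM (x : Model n) : dprojM n k H (D.prM x) = dprojM n k H x := by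
  have h : D.prM (x - D.prM x) = 0 := by
    rw [map_sub, D.prM_of_mem (D.prM_mem x), sub_self]
  have h2 := D.prM_eq_zero_iff.1 h
  rw [map_sub, sub_eq_zero] at h2
  exact h2.symm

theorem mM_ext {x y : Model n} (hx : x ∈ D.mM) (hy : y ∈ D.mM)
    (h : dprojM n k H x = dprojM n k H y) : x = y := by
  have h1 : D.prM (x - y) = 0 := D.prM_eq_zero_iff.2 (by rw [map_sub, h, sub_self])
  rwa [D.prM_of_mem (D.mM.sub_mem hx hy), sub_eq_zero] at h1

theorem adM_mem {h : G} (hh : h ∈ H) {x : Model n} (hx : x ∈ D.mM) : adM h x ∈ D.mM := by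
  have h1 := D.map_Ad h hh
  have h2 : (adM h x : GroupLieAlgebra (𝓡 n) G) ∈
      D.m.map (Ad n h : GroupLieAlgebra (𝓡 n) G →ₗ[ℝ] GroupLieAlgebra (𝓡 n) G) :=
    ⟨x, hx, rfl⟩
  rw [h1] at h2
  exact h2

variable [hs : IsHomogeneousSpace n k H]

/-- The inverse of the identification `𝔪 ≃ T_H (G ⧸ H)`, as a map of the model spaces. -/
def liftM : Model k →L[ℝ] Model n :=
  LinearMap.toContinuousLinearMap
    (show Model k →ₗ[ℝ] Model n from D.m.subtype ∘ₗ D.tangentEquiv.symm.toLinearMap)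

theorem liftM_mem (v : Model k) : D.liftM v ∈ D.mM := (D.tangentEquiv.symm v).2

theorem dprojM_liftM (v : Model k) : dprojM n k H (D.liftM v) = v :=
  D.tangentEquiv.apply_symm_apply v

theorem liftM_dprojM (x : Model n) : D.liftM (dprojM n k H x) = D.prM x :=
  D.mM_ext (D.liftM_mem _) (D.prM_mem _) (by rw [dprojM_liftM, dprojM_prM])

/-- The function `f_X`, with values in the model space underlying the Lie algebra. -/
def coordM (X : VField k H) (g : G) : Model n := D.toModel (D.coord X g)

theorem coordM_eq (X : VField k H) (g : G) :
    D.coordM X g = D.liftM (dtransM g⁻¹ (QuotientGroup.mk g : G ⧸ H) (X (QuotientGroup.mk g))) :=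
  rfl

theorem coordM_mem (X : VField k H) (g : G) : D.coordM X g ∈ D.mM := (D.coord X g).2

theorem dtransM_dprojM_coordM (X : VField k H) (g : G) :
    dtransM g (origin H) (dprojM n k H (D.coordM X g)) = X (QuotientGroup.mk g) := by
  rw [coordM_eq, dprojM_liftM]
  exact dtransM_dtransM_inv (n := n) g (by rw [smul_mk, mul_one]) _

/-- The function `f_X` is characterised by the property that its values are the coefficients of
the horizontal lift of `X`. -/
theorem coordM_eq_prM (X : VField k H) (g : G) {x : Model n}
    (h : X (QuotientGroup.mk g) = dtransM g (origin H) (dprojM n k H x)) :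
    D.coordM X g = D.prM x := by
  rw [← liftM_dprojM, coordM_eq]
  have h2 : (X (QuotientGroup.mk g) : Model k) = dtransM g (origin H) (dprojM n k H x) := h
  have h3 : dtransM g⁻¹ (QuotientGroup.mk g : G ⧸ H)
      (dtransM g (origin H) (dprojM n k H x)) = dprojM n k H x :=
    dtransM_inv_dtransM (n := n) g (by rw [smul_mk, mul_one]) _
  exact congrArg D.liftM ((congrArg (dtransM g⁻¹ (QuotientGroup.mk g : G ⧸ H)) h2).trans h3)

variable [LieGroup (𝓡 n) ∞ G]

theorem prM_adM {h : G} (hh : h ∈ H) (x : Model n) : D.prM (adM h x) = adM h (D.prM x) :=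
  D.mM_ext (D.prM_mem _) (D.adM_mem hh (D.prM_mem _)) (by
    rw [dprojM_prM, ← dtransM_dprojM hh, ← dtransM_dprojM hh, dprojM_prM])

/-- The horizontal lift of `X` projects to `X`. -/
theorem mfderiv_mk_coordM (X : VField k H) (g : G) :
    mfderiv (𝓡 n) (𝓡 k) (QuotientGroup.mk : G → G ⧸ H) g (leftVec g (D.coordM X g)) =
      X (QuotientGroup.mk g) :=
  (mfderiv_mk_leftVec g _).trans (D.dtransM_dprojM_coordM X g)

/-- The function `f_X` is `Ad(H)`-equivariant. -/
theorem coordM_mul (X : VField k H) (g : G) {h : G} (hh : h ∈ H) :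
    D.coordM X (g * h) = adM h⁻¹ (D.coordM X g) := by
  rw [← D.prM_of_mem (D.adM_mem (inv_mem hh) (D.coordM_mem X g))]
  apply D.coordM_eq_prM
  have hg : (QuotientGroup.mk (g * h) : G ⧸ H) = QuotientGroup.mk g := by
    rw [QuotientGroup.eq]; simpa using hh
  rw [← dtransM_dprojM (inv_mem hh), dtransM_comp (n := n) (p' := origin H)]
  · rw [mul_inv_cancel_right, hg]
    exact (D.dtransM_dprojM_coordM X g).symm
  · rw [smul_mk, QuotientGroup.eq]; simpa using hh

theorem contMDiff_coordM [IsManifold (𝓡 k) ∞ (G ⧸ H)] {X : VField k H} (hX : IsSmoothField X) :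
    ContMDiff (𝓡 n) 𝓘(ℝ, Model n) ∞ (D.coordM X) := by
  intro g
  have h := contMDiffAt_mfderiv_prod (contMDiff_action n k H)
    (a := fun q : G => (⟨q⁻¹, 0⟩ : TangentBundle (𝓡 n) G))
    (b := fun q : G => (⟨QuotientGroup.mk q, X (QuotientGroup.mk q)⟩ :
      TangentBundle (𝓡 k) (G ⧸ H))) (q := g) (K := 𝓡 n)
    ((contMDiff_zeroSection ℝ (TangentSpace (𝓡 n) : G → Type _) _).comp g
      (contMDiff_inv (𝓡 n) ∞ g))
    ((hX _).comp g (contMDiff_mk g))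
  have h2 : ContMDiffAt (𝓡 n) (𝓡 k).tangent ∞ (fun q : G => (⟨origin H,
      dtransM q⁻¹ (QuotientGroup.mk q : G ⧸ H) (X (QuotientGroup.mk q))⟩ :
        TangentBundle (𝓡 k) (G ⧸ H))) g := by
    refine h.congr_of_eventuallyEq (Filter.Eventually.of_forall fun q => ?_)
    refine tangentBundle_mk_eq (by rw [smul_mk, inv_mul_cancel]) ?_
    have h0 := map_zero (mfderiv (𝓡 n) (𝓡 k)
      (fun z : G => z • (QuotientGroup.mk q : G ⧸ H)) q⁻¹)
    exact ((congrArg (fun w : Model k => w +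
      dtransM q⁻¹ (QuotientGroup.mk q : G ⧸ H) (X (QuotientGroup.mk q))) h0).trans
        (zero_add _)).symm
  rw [contMDiffAt_tangent_const_iff] at h2
  exact (D.liftM.contMDiff _).comp g h2

end ReductiveDecomposition

theorem comp_smulRight_one {E F : Type*} [NormedAddCommGroup E] [NormedSpace ℝ E]
    [NormedAddCommGroup F] [NormedSpace ℝ F] (A : E →L[ℝ] F) (w : E) :
    A ∘L (1 : ℝ →L[ℝ] ℝ).smulRight w = (1 : ℝ →L[ℝ] ℝ).smulRight (A w) := by
  ext; simp

/-- If `Ad(b⁻¹) v` is tangent to `H`, then the flow of the left-invariant field of `v` through `1`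
fixes the point `bH`. -/
theorem mk_mul_eq_of_integral_curve [hs : IsHomogeneousSpace n k H] [LieGroup (𝓡 n) ∞ G]
    [IsManifold (𝓡 k) ∞ (G ⧸ H)] {v : Model n} {ε : ℝ} {c : ℝ → G}
    (hc : ∀ t ∈ Ioo (-ε) ε, HasMFDerivAt 𝓘(ℝ, ℝ) (𝓡 n) c t
      ((1 : ℝ →L[ℝ] ℝ).smulRight (leftVec (c t) v)))
    {b : G} (hv : dprojM n k H (adM b⁻¹ v) = 0) {t : ℝ} (ht : t ∈ Ioo (-ε) ε) :
    (QuotientGroup.mk (c t * b) : G ⧸ H) = QuotientGroup.mk (c 0 * b) := by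
  have : IsTopologicalGroup G := topologicalGroup_of_lieGroup (𝓡 n) ∞
  have := hs.isClosed
  have h1 : ∀ s ∈ Ioo (-ε) ε, HasMFDerivAt 𝓘(ℝ, ℝ) (𝓡 k)
      (fun s => (QuotientGroup.mk (c s * b) : G ⧸ H)) s 0 := by
    intro s hs'
    have hmk : MDifferentiableAt (𝓡 n) (𝓡 k) (fun a : G => (QuotientGroup.mk (a * b) : G ⧸ H))
        (c s) := (mdifferentiable_mk (k := k) (H := H) (c s * b)).comp (c s)
          (mdifferentiable_mul_right' b (c s))
    have h2 := hmk.hasMFDerivAt.comp s (hc s hs')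
    have hz : mfderiv (𝓡 n) (𝓡 k) (fun a : G => (QuotientGroup.mk (a * b) : G ⧸ H)) (c s)
        (leftVec (c s) v) = 0 := by
      refine (mfderiv_comp_apply (I := 𝓡 n) (I' := 𝓡 n) (I'' := 𝓡 k) (c s)
        (mdifferentiable_mk (k := k) (H := H) (c s * b)) (mdifferentiable_mul_right' b (c s))
        (leftVec (c s) v)).trans ((congrArg (mfderiv (𝓡 n) (𝓡 k)
        (QuotientGroup.mk : G → G ⧸ H) (c s * b)) (mfderiv_mul_right_leftVec (c s) b v)).trans ?_)
      rw [mfderiv_mk_leftVec, hv]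
      exact map_zero _
    have h3 := comp_smulRight_one (E := Model n) (F := Model k)
      (mfderiv (𝓡 n) (𝓡 k) (fun a : G => (QuotientGroup.mk (a * b) : G ⧸ H)) (c s))
      (leftVec (c s) v)
    have h4 := h3.trans (congrArg (fun w : Model k => (1 : ℝ →L[ℝ] ℝ).smulRight w) hz)
    have h5 : (1 : ℝ →L[ℝ] ℝ).smulRight (0 : Model k) = 0 := by ext; simp
    exact (congrArg (fun L : ℝ →L[ℝ] Model k => HasMFDerivAt 𝓘(ℝ, ℝ) (𝓡 k)
      (fun s => (QuotientGroup.mk (c s * b) : G ⧸ H)) s L) (h4.trans h5)).mp h2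
  exact eq_of_hasMFDerivAt_zero h1 ht

/-- A tangent vector of `H` at `1` is tangent to a curve in `H`. -/
theorem exists_curve_in_subgroup [hs : IsHomogeneousSpace n k H] [LieGroup (𝓡 n) ∞ G]
    [IsManifold (𝓡 k) ∞ (G ⧸ H)] {v : Model n} (hv : dprojM n k H v = 0) :
    ∃ ε > 0, ∃ c : ℝ → G, c 0 = 1 ∧ (∀ t ∈ Ioo (-ε) ε, c t ∈ H) ∧
      HasMFDerivAt 𝓘(ℝ, ℝ) (𝓡 n) c 0 ((1 : ℝ →L[ℝ] ℝ).smulRight (leftVec (c 0) v)) := by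
  obtain ⟨ε, hε, c, hc0, hc⟩ := exists_integral_curve (1 : G)
    (contMDiff_leftVec (a := fun _ : G => v) contMDiff_const)
  refine ⟨ε, hε, c, hc0, fun t ht => ?_, hc 0 (by constructor <;> linarith)⟩
  have h3 := mk_mul_eq_of_integral_curve (k := k) (H := H) hc (b := 1)
    (by rw [inv_one, adM_one, hv]) ht
  rw [hc0, mul_one, mul_one, eq_comm, QuotientGroup.eq] at h3
  simpa using h3

/-- Two functions which agree on `H` have the same derivatives along the vectors tangent to `H`. -/
theorem leftDeriv_eq_of_eqOn [hs : IsHomogeneousSpace n k H] [LieGroup (𝓡 n) ∞ G]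
    [IsManifold (𝓡 k) ∞ (G ⧸ H)] {F : Type*} [NormedAddCommGroup F] [NormedSpace ℝ F]
    {f f' : G → F} (hf : MDifferentiableAt (𝓡 n) 𝓘(ℝ, F) f 1)
    (hf' : MDifferentiableAt (𝓡 n) 𝓘(ℝ, F) f' 1) (h : ∀ a ∈ H, f a = f' a)
    {v : Model n} (hv : dprojM n k H v = 0) : leftDeriv v f 1 = leftDeriv v f' 1 := by
  obtain ⟨ε, hε, c, hc0, hcH, hc⟩ := exists_curve_in_subgroup hv
  have key : ∀ f : G → F, MDifferentiableAt (𝓡 n) 𝓘(ℝ, F) f 1 →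
      HasDerivAt (fun t => f (c t)) (leftDeriv v f 1) 0 := by
    intro f hf
    have h1 : HasMFDerivAt (𝓡 n) 𝓘(ℝ, F) f (c 0) (mfderiv (𝓡 n) 𝓘(ℝ, F) f (c 0)) := by
      rw [hc0]; exact hf.hasMFDerivAt
    have h2 := h1.comp 0 hc
    rw [hasMFDerivAt_iff_hasFDerivAt] at h2
    have h3 := comp_smulRight_one (E := Model n) (F := F)
      (mfderiv (𝓡 n) 𝓘(ℝ, F) f (c 0)) (leftVec (c 0) v)
    have h4 : HasFDerivAt (f ∘ c) ((1 : ℝ →L[ℝ] ℝ).smulRight (leftDeriv v f (c 0))) 0 :=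
      (congrArg (fun L : ℝ →L[ℝ] F => HasFDerivAt (f ∘ c) L 0) h3).mp h2
    rw [hc0] at h4
    have h5 : (1 : ℝ →L[ℝ] ℝ).smulRight (leftDeriv v f 1) 1 = leftDeriv v f 1 := by simp
    exact h5 ▸ h4.hasDerivAt
  refine (key f hf).unique ((key f' hf').congr_of_eventuallyEq ?_)
  filter_upwards [Ioo_mem_nhds (neg_lt_zero.2 hε) hε] with t ht
  exact h _ (hcH t ht)

end Reductive

/-! ### The isotropy representation and the product -/

section ProductRule

variable {E : Type*} [NormedAddCommGroup E] [NormedSpace ℝ E] {EH : Type*} [TopologicalSpace EH]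
  {I : ModelWithCorners ℝ E EH} {M : Type*} [TopologicalSpace M] [ChartedSpace EH M]
  {F : Type*} [NormedAddCommGroup F] [NormedSpace ℝ F]
  {F' : Type*} [NormedAddCommGroup F'] [NormedSpace ℝ F']
  {F'' : Type*} [NormedAddCommGroup F''] [NormedSpace ℝ F'']

/-- The product rule for a continuous bilinear map. -/
theorem mvfderiv_bilinear [I.Boundaryless] (B : F →L[ℝ] F' →L[ℝ] F'') {f : M → F} {g : M → F'}
    {x : M} (hf : MDifferentiableAt I 𝓘(ℝ, F) f x) (hg : MDifferentiableAt I 𝓘(ℝ, F') g x)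
    (v : TangentSpace I x) :
    mvfderiv I (fun y => B (f y) (g y)) x v =
      B (mvfderiv I f x v) (g x) + B (f x) (mvfderiv I g x v) := by
  have hf' : DifferentiableAt ℝ (f ∘ (extChartAt I x).symm) (extChartAt I x x) := by
    have := ((mdifferentiableAt_iff _ _).1 hf).2
    rwa [I.range_eq_univ, differentiableWithinAt_univ] at this
  have hg' : DifferentiableAt ℝ (g ∘ (extChartAt I x).symm) (extChartAt I x x) := by
    have := ((mdifferentiableAt_iff _ _).1 hg).2
    rwa [I.range_eq_univ, differentiableWithinAt_univ] at this
  have h := B.hasFDerivAt_of_bilinear hf'.hasFDerivAt hg'.hasFDerivAt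
  have hB : MDifferentiableAt I 𝓘(ℝ, F'') (fun y => B (f y) (g y)) x :=
    (B.mdifferentiableAt.comp x hf).clm_apply hg
  rw [mvfderiv_apply_eq_fderiv_chart hB, mvfderiv_apply_eq_fderiv_chart hf,
    mvfderiv_apply_eq_fderiv_chart hg]
  have h2 := congrArg (fun L : E →L[ℝ] F'' => L v) h.fderiv
  simp only [Function.comp_apply, extChartAt_to_inv] at h2
  refine h2.trans ?_
  rw [add_comm]
  rfl

end ProductRule

section Isotropy

variable {n k : ℕ} {G : Type*} [TopologicalSpace G] [Group G] [ChartedSpace (Model n) G]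
  {H : Subgroup G} [ChartedSpace (Model k) (G ⧸ H)] [hs : IsHomogeneousSpace n k H]
  [LieGroup (𝓡 n) ∞ G] [IsManifold (𝓡 k) ∞ (G ⧸ H)]

theorem adInv_one (y : Model n) : adInv y (1 : G) = y := by
  rw [adInv, inv_one, adM_one]

theorem mdifferentiableAt_adInv (y : Model n) (g : G) :
    MDifferentiableAt (𝓡 n) 𝓘(ℝ, Model n) (adInv y : G → Model n) g :=
  (contMDiff_adInv y g).mdifferentiableAt (by simp)

theorem leftDeriv_const {F : Type*} [NormedAddCommGroup F] [NormedSpace ℝ F] (x : Model n) (c : F)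
    (g : G) : leftDeriv x (fun _ : G => c) g = 0 := by
  rw [leftDeriv, mvfderiv_const]; rfl

variable (Om : InvariantSymplecticForm k H)

/-- The form `ω`, as a degenerate bilinear form on the model space underlying `𝔤`. -/
def omM : Model n →L[ℝ] Model n →L[ℝ] ℝ :=
  ContinuousLinearMap.bilinearComp
    (show Model k →L[ℝ] Model k →L[ℝ] ℝ from Om.form (origin H)) (dprojM n k H) (dprojM n k H)

theorem omM_apply (x y : Model n) :
    omM Om x y = Om.form (origin H) (dprojM n k H x) (dprojM n k H y) := rfl

theorem omM_skew (x y : Model n) : omM Om x y = -omM Om y x := by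
  have h0 : ∀ z : Model n, omM Om z z = 0 := fun z => Om.alternating _ _
  have h := h0 (x + y)
  simp only [map_add, add_apply, h0] at h
  linarith

theorem omM_adM {h : G} (hh : h ∈ H) (x y : Model n) :
    omM Om (adM h x) (adM h y) = omM Om x y := by
  rw [omM_apply, ← dtransM_dprojM hh, ← dtransM_dprojM hh]
  have h1 : ∀ p : G ⧸ H, p = origin H → ∀ (v w : Model k) (c : ℝ), Om.form p v w = c →
      Om.form (origin H) v w = c := by
    rintro p rfl v w c hc; exact hc
  refine h1 (h • origin H) ?_ _ _ _ (Om.invariant h (origin H) _ _)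
  rw [smul_mk, QuotientGroup.eq]; simpa using hh

/-- The infinitesimal version of the invariance of `ω` under `Ad(H)`. -/
theorem omM_lieB_of_isotropy {v : Model n} (hv : dprojM n k H v = 0) (y z : Model n) :
    omM Om (lieB G v y) z + omM Om y (lieB G v z) = 0 := by
  have h := leftDeriv_eq_of_eqOn (k := k) (H := H)
    (f := fun g : G => omM Om (adInv y g) (adInv z g)) (f' := fun _ => omM Om y z)
    (((((omM Om).contMDiff.comp (contMDiff_adInv y)).clm_apply (contMDiff_adInv z)) 1
      ).mdifferentiableAt (by simp)) mdifferentiableAt_const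
    (fun a ha => omM_adM Om (inv_mem ha) y z) hv
  rw [leftDeriv_const] at h
  have h2 := mvfderiv_bilinear (omM Om) (mdifferentiableAt_adInv y (1 : G))
    (mdifferentiableAt_adInv z (1 : G)) (leftVec 1 v)
  have h3 := leftDeriv_adInv v y (1 : G)
  have h4 := leftDeriv_adInv v z (1 : G)
  unfold leftDeriv at h h3 h4
  rw [h, h3, h4, adInv_one, adInv_one, map_neg, map_neg, neg_apply] at h2
  linarith

namespace ReductiveDecomposition

variable (D : ReductiveDecomposition n k H)

include D in
/-- `[𝔥, 𝔪] ⊆ 𝔪`. -/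
theorem lieB_mem {v : Model n} (hv : dprojM n k H v = 0) {y : Model n} (hy : y ∈ D.mM) :
    lieB G v y ∈ D.mM := by
  set A : Model n →L[ℝ] Model n := ContinuousLinearMap.id ℝ _ - D.prM with hA
  have h0 : ∀ x ∈ D.mM, A x = 0 := fun x hx => by simp [hA, D.prM_of_mem hx]
  have h := leftDeriv_eq_of_eqOn (k := k) (H := H) (f := fun g : G => A (adInv y g))
    (f' := fun _ => 0) ((A.contMDiff.comp (contMDiff_adInv y) 1).mdifferentiableAt (by simp))
    mdifferentiableAt_const (fun a ha => h0 _ (D.adM_mem (inv_mem ha) hy)) hv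
  rw [leftDeriv_const] at h
  have h2 := mvfderiv_clm_comp A (mdifferentiableAt_adInv y (1 : G)) (leftVec 1 v)
  have h3 := leftDeriv_adInv v y (1 : G)
  unfold leftDeriv at h h3
  rw [h, h3, adInv_one, map_neg, zero_eq_neg] at h2
  have h4 : lieB G v y - D.prM (lieB G v y) = 0 := h2
  rw [sub_eq_zero.1 h4]
  exact D.prM_mem _

theorem prM_lieB_of_isotropy {v : Model n} (hv : dprojM n k H v = 0) (y : Model n) :
    D.prM (lieB G v y) = lieB G v (D.prM y) := by
  have h := leftDeriv_eq_of_eqOn (k := k) (H := H) (f := fun g : G => D.prM (adInv y g))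
    (f' := adInv (D.prM y)) ((D.prM.contMDiff.comp (contMDiff_adInv y) 1).mdifferentiableAt
      (by simp)) (mdifferentiableAt_adInv _ _) (fun a ha => D.prM_adM (inv_mem ha) y) hv
  rw [leftDeriv_adInv, adInv_one] at h
  have h2 := mvfderiv_clm_comp D.prM (mdifferentiableAt_adInv y (1 : G)) (leftVec 1 v)
  have h3 := leftDeriv_adInv v y (1 : G)
  unfold leftDeriv at h h3
  rw [h, h3, adInv_one, map_neg, neg_inj] at h2
  exact h2.symm

/-- Along the fibres of `G → G ⧸ H`, the derivative of an equivariant function is given by the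
bracket. -/
theorem leftDeriv_of_isotropy {f : G → Model n} (hf : ContMDiff (𝓡 n) 𝓘(ℝ, Model n) ∞ f)
    (hH : ∀ g, ∀ h ∈ H, f (g * h) = adM h⁻¹ (f g)) {v : Model n} (hv : dprojM n k H v = 0)
    (g : G) : leftDeriv v f g = -lieB G v (f g) := by
  have h := leftDeriv_eq_of_eqOn (k := k) (H := H) (f := fun a : G => f (g * a))
    (f' := adInv (f g)) ((hf.comp (contMDiff_mul_left (I := 𝓡 n) (n := ∞) (a := g)) 1
      ).mdifferentiableAt (by simp)) (mdifferentiableAt_adInv _ _) (fun a ha => hH g a ha) hv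
  rw [leftDeriv_adInv, adInv_one] at h
  rw [← h]
  have h2 := mvfderiv_comp_apply' (I := 𝓡 n) (I' := 𝓡 n) (f := f) (φ := fun a : G => g * a) (1 : G)
    ((hf _).mdifferentiableAt (by simp)) (mdifferentiable_mul_left' g 1) (leftVec 1 v)
  have h3 := mfderiv_mul_left_leftVec g 1 v
  refine Eq.trans ?_ (h2.trans (congrArg (mvfderiv (𝓡 n) f (g * 1)) h3)).symm
  rw [mul_one]
  rfl

/-- The form `ω` is nondegenerate on `𝔪`. -/
theorem omM_nondegenerate {x : Model n} (hx : x ∈ D.mM) (h : ∀ z ∈ D.mM, omM Om x z = 0) :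
    x = 0 := by
  refine D.mM_ext hx (D.mM.zero_mem) ?_
  rw [map_zero]
  refine Om.nondegenerate (origin H) _ fun w => ?_
  exact (congrArg (fun w : Model k => Om.form (origin H) (dprojM n k H x) w)
    (D.dprojM_liftM w)).symm.trans (h _ (D.liftM_mem w))

theorem omM_ext {x y : Model n} (hx : x ∈ D.mM) (hy : y ∈ D.mM)
    (h : ∀ z ∈ D.mM, omM Om x z = omM Om y z) : x = y := by
  rw [← sub_eq_zero]
  refine D.omM_nondegenerate Om (D.mM.sub_mem hx hy) fun z hz => ?_
  rw [map_sub, sub_apply, h z hz, sub_self]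

theorem omM_prM_left (x y : Model n) : omM Om (D.prM x) y = omM Om x y := by
  rw [omM_apply, omM_apply, dprojM_prM]

theorem omM_prM_right (x y : Model n) : omM Om x (D.prM y) = omM Om x y := by
  rw [omM_apply, omM_apply, dprojM_prM]

/-- The product `L^{0,1}`, as a bilinear map on `𝔪`. -/
def prodLin : D.m →ₗ[ℝ] D.m →ₗ[ℝ] D.m :=
  have key : ∀ a b : D.m, (∀ z, D.tensor Om a z = D.tensor Om b z) → a = b := fun a b h =>
    sub_eq_zero.1 ((D.tensor_nondegenerate Om).1 _ fun z => by
      rw [map_sub, LinearMap.sub_apply, h z, sub_self])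
  LinearMap.mk₂ ℝ (D.productL Om 0 1)
    (fun x x' y => key _ _ fun z => by simp [tensor_productL])
    (fun c x y => key _ _ fun z => by simp [tensor_productL])
    (fun x y y' => key _ _ fun z => by simp [tensor_productL])
    (fun c x y => key _ _ fun z => by simp [tensor_productL])

/-- The product `L^{0,1}`, extended to the model space underlying `𝔤` by the projection to `𝔪`. -/
def prodM : Model n →L[ℝ] Model n →L[ℝ] Model n :=
  (show Model n →ₗ[ℝ] Model n →ₗ[ℝ] Model n from
    ((D.prodLin Om).compl₁₂ D.projM D.projM).compr₂ D.m.subtype).toContinuousBilinearMap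

theorem prodM_mem (x y : Model n) : D.prodM Om x y ∈ D.mM :=
  (D.prodLin Om (D.projM x) (D.projM y)).2

theorem prodM_coe (x y : D.m) :
    D.prodM Om (D.toModel x) (D.toModel y) = D.toModel (D.productL Om 0 1 x y) := by
  have h : ∀ x : D.m, D.projM x = x := Submodule.projectionOnto_apply_left D.isCompl.symm
  have h1 : D.prodM Om (D.toModel x) (D.toModel y) =
    D.toModel (D.productL Om 0 1 (D.projM x) (D.projM y)) := rfl
  rw [h1, h, h]

/-- The defining property of `L^{0,1}`. -/
theorem omM_prodM {x y z : Model n} (hx : x ∈ D.mM) (hy : y ∈ D.mM) (hz : z ∈ D.mM) :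
    omM Om (D.prodM Om x y) z = omM Om (lieB G x z) y := by
  have h := D.tensor_productL Om 0 1 ⟨x, hx⟩ ⟨y, hy⟩ ⟨z, hz⟩
  rw [zero_mul, zero_add, one_mul] at h
  have h1 := D.prodM_coe Om ⟨x, hx⟩ ⟨y, hy⟩
  have h2 : omM Om (D.toModel (D.productL Om 0 1 ⟨x, hx⟩ ⟨y, hy⟩)) z =
    omM Om (D.prM (lieB G x z)) y := h
  rw [← h1, omM_prM_left] at h2
  exact h2

theorem prodM_adM {h : G} (hh : h ∈ H) {x y : Model n} (hx : x ∈ D.mM) (hy : y ∈ D.mM) :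
    D.prodM Om (adM h x) (adM h y) = adM h (D.prodM Om x y) := by
  refine D.omM_ext Om (D.prodM_mem Om _ _) (D.adM_mem hh (D.prodM_mem Om _ _)) fun z hz => ?_
  have hz' := D.adM_mem (inv_mem hh) hz
  rw [D.omM_prodM Om (D.adM_mem hh hx) (D.adM_mem hh hy) hz]
  rw [← adM_adM_inv h z, ← adM_lieB, omM_adM Om hh, omM_adM Om hh, D.omM_prodM Om hx hy hz']

end ReductiveDecomposition
end Isotropy

/-! ### The zero-one connection -/

section Connection

variable {n k : ℕ} {G : Type*} [TopologicalSpace G] [Group G] [ChartedSpace (Model n) G]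
  {H : Subgroup G} [ChartedSpace (Model k) (G ⧸ H)] [hs : IsHomogeneousSpace n k H]
  [LieGroup (𝓡 n) ∞ G] [IsManifold (𝓡 k) ∞ (G ⧸ H)]

theorem contMDiff_leftDeriv {F : Type*} [NormedAddCommGroup F] [NormedSpace ℝ F]
    {a : G → Model n} {f : G → F} (ha : ContMDiff (𝓡 n) 𝓘(ℝ, Model n) ∞ a)
    (hf : ContMDiff (𝓡 n) 𝓘(ℝ, F) ∞ f) :
    ContMDiff (𝓡 n) 𝓘(ℝ, F) ∞ (fun g => leftDeriv (a g) f g) :=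
  contMDiff_mvfderiv_field hf (contMDiff_leftVec ha)

/-- The derivative of an equivariant function along the horizontal lift of a vector field is again
equivariant. -/
theorem leftDeriv_mul_right {f : G → Model n} (hf : ContMDiff (𝓡 n) 𝓘(ℝ, Model n) ∞ f) {h : G}
    (hh : ∀ g, f (g * h) = adM h⁻¹ (f g)) (x : Model n) (g : G) :
    leftDeriv (adM h⁻¹ x) f (g * h) = adM h⁻¹ (leftDeriv x f g) := by
  have h1 := mvfderiv_comp_apply' (I := 𝓡 n) (I' := 𝓡 n) (f := f) (φ := fun a : G => a * h) g
    ((hf _).mdifferentiableAt (by simp)) (mdifferentiable_mul_right' h g) (leftVec g x)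
  have h2 := mfderiv_mul_right_leftVec g h x
  have h3 := mvfderiv_clm_comp (adM h⁻¹) ((hf g).mdifferentiableAt (by simp)) (leftVec g x)
  have h4 : (fun a : G => f (a * h)) = fun a => adM h⁻¹ (f a) := funext hh
  rw [h4] at h1
  exact (h1.trans (congrArg (mvfderiv (𝓡 n) f (g * h)) h2)).symm.trans h3

theorem leftDeriv_mul_left {F : Type*} [NormedAddCommGroup F] [NormedSpace ℝ F] {f : G → F}
    (hf : ContMDiff (𝓡 n) 𝓘(ℝ, F) ∞ f) (x : Model n) (a g : G) :
    leftDeriv x (fun z => f (a * z)) g = leftDeriv x f (a * g) :=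
  (mvfderiv_comp_apply' (I := 𝓡 n) (I' := 𝓡 n) (f := f) (φ := fun z : G => a * z) g
    ((hf _).mdifferentiableAt (by simp)) (mdifferentiable_mul_left' a g) (leftVec g x)).trans
    (congrArg (mvfderiv (𝓡 n) f (a * g)) (mfderiv_mul_left_leftVec a g x))

theorem isSmoothField_add {X Y : VField k H} (hX : IsSmoothField X) (hY : IsSmoothField Y) :
    IsSmoothField (X + Y) :=
  ContMDiff.add_section hX hY

theorem isSmoothField_fsmul {φ : G ⧸ H → ℝ} {X : VField k H}
    (hφ : ContMDiff (𝓡 k) 𝓘(ℝ, ℝ) ∞ φ) (hX : IsSmoothField X) : IsSmoothField (fsmul φ X) :=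
  ContMDiff.smul_section hφ hX

namespace ReductiveDecomposition

variable (D : ReductiveDecomposition n k H) (Om : InvariantSymplecticForm k H)

theorem leftDeriv_mem {f : G → Model n} (hf : ContMDiff (𝓡 n) 𝓘(ℝ, Model n) ∞ f)
    (hm : ∀ g, f g ∈ D.mM) (x : Model n) (g : G) : leftDeriv x f g ∈ D.mM := by
  have h1 := mvfderiv_clm_comp D.prM ((hf g).mdifferentiableAt (by simp)) (leftVec g x)
  have h2 : (fun a : G => D.prM (f a)) = f := funext fun a => D.prM_of_mem (hm a)
  rw [h2] at h1
  rw [leftDeriv, h1]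
  exact D.prM_mem _

theorem nablaCoord_eq (X Y : VField k H) (g : G) :
    D.nablaCoord (D.productL Om 0 1) X Y g =
      leftDeriv (D.coordM X g) (D.coordM Y) g + D.prodM Om (D.coordM X g) (D.coordM Y g) :=
  congrArg (leftDeriv (D.coordM X g) (D.coordM Y) g + ·) (D.prodM_coe Om _ _).symm

theorem contMDiff_nablaCoord {X Y : VField k H} (hX : IsSmoothField X) (hY : IsSmoothField Y) :
    ContMDiff (𝓡 n) 𝓘(ℝ, Model n) ∞ (D.nablaCoord (D.productL Om 0 1) X Y) := by
  rw [funext (D.nablaCoord_eq Om X Y)]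
  exact (contMDiff_leftDeriv (D.contMDiff_coordM hX) (D.contMDiff_coordM hY)).add
    (((D.prodM Om).contMDiff.comp (D.contMDiff_coordM hX)).clm_apply (D.contMDiff_coordM hY))

theorem nablaCoord_mem {X Y : VField k H} (hY : IsSmoothField Y) (g : G) :
    D.nablaCoord (D.productL Om 0 1) X Y g ∈ D.mM := by
  rw [nablaCoord_eq]
  exact D.mM.add_mem (D.leftDeriv_mem (D.contMDiff_coordM hY) (D.coordM_mem Y) _ _)
    (D.prodM_mem Om _ _)

theorem nablaCoord_mul {X Y : VField k H} (hY : IsSmoothField Y) (g : G) {h : G} (hh : h ∈ H) :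
    D.nablaCoord (D.productL Om 0 1) X Y (g * h) =
      adM h⁻¹ (D.nablaCoord (D.productL Om 0 1) X Y g) := by
  rw [nablaCoord_eq, nablaCoord_eq, D.coordM_mul X g hh, D.coordM_mul Y g hh,
    D.prodM_adM Om (inv_mem hh) (D.coordM_mem X g) (D.coordM_mem Y g), map_add,
    leftDeriv_mul_right (D.contMDiff_coordM hY) (fun g => D.coordM_mul Y g hh)]

/-- The definition of `∇_X Y` does not depend on the choice of representatives. -/
theorem zeroOne_mk {X Y : VField k H} (hY : IsSmoothField Y) (g : G) :
    D.zeroOne Om X Y (QuotientGroup.mk g) = dtransM g (origin H)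
      (dprojM n k H (D.nablaCoord (D.productL Om 0 1) X Y g)) :=
  dtransM_dprojM_eq (fun g _ hh => D.nablaCoord_mul Om hY g hh) (Quotient.out_eq _)

/-- The function of `∇_X Y`. -/
theorem coordM_zeroOne {X Y : VField k H} (hY : IsSmoothField Y) (g : G) :
    D.coordM (D.zeroOne Om X Y) g =
      leftDeriv (D.coordM X g) (D.coordM Y) g + D.prodM Om (D.coordM X g) (D.coordM Y g) := by
  rw [D.coordM_eq_prM _ g (D.zeroOne_mk Om hY g), D.prM_of_mem (D.nablaCoord_mem Om hY g),
    nablaCoord_eq]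

theorem isSmoothField_zeroOne {X Y : VField k H} (hX : IsSmoothField X) (hY : IsSmoothField Y) :
    IsSmoothField (D.zeroOne Om X Y) :=
  isSmoothField_of_lift (D.contMDiff_nablaCoord Om hX hY) (D.zeroOne_mk Om hY)

theorem field_ext {X Y : VField k H} (h : ∀ g, D.coordM X g = D.coordM Y g) : X = Y := by
  funext p
  obtain ⟨g, rfl⟩ := QuotientGroup.mk_surjective p
  exact (D.dtransM_dprojM_coordM X g).symm.trans ((congrArg (fun x : Model n =>
    dtransM g (origin H) (dprojM n k H x)) (h g)).trans (D.dtransM_dprojM_coordM Y g))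

theorem coordM_add (X Y : VField k H) (g : G) :
    D.coordM (X + Y) g = D.coordM X g + D.coordM Y g :=
  (D.liftM ∘L dtransM g⁻¹ (QuotientGroup.mk g : G ⧸ H)).map_add (X (QuotientGroup.mk g))
    (Y (QuotientGroup.mk g))

theorem coordM_sub (X Y : VField k H) (g : G) :
    D.coordM (X - Y) g = D.coordM X g - D.coordM Y g :=
  (D.liftM ∘L dtransM g⁻¹ (QuotientGroup.mk g : G ⧸ H)).map_sub (X (QuotientGroup.mk g))
    (Y (QuotientGroup.mk g))

theorem coordM_zero (g : G) : D.coordM (0 : VField k H) g = 0 :=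
  (D.liftM ∘L dtransM g⁻¹ (QuotientGroup.mk g : G ⧸ H)).map_zero

theorem coordM_fsmul (φ : G ⧸ H → ℝ) (X : VField k H) (g : G) :
    D.coordM (fsmul φ X) g = φ (QuotientGroup.mk g) • D.coordM X g :=
  (D.liftM ∘L dtransM g⁻¹ (QuotientGroup.mk g : G ⧸ H)).map_smul (φ (QuotientGroup.mk g))
    (X (QuotientGroup.mk g))

theorem coordM_pushforward (a : G) (X : VField k H) (g : G) :
    D.coordM (pushforward a X) g = D.coordM X (a⁻¹ * g) := by
  rw [← D.prM_of_mem (D.coordM_mem X (a⁻¹ * g))]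
  apply D.coordM_eq_prM
  have h1 : pushforward a X (QuotientGroup.mk g) = dtransM a (QuotientGroup.mk (a⁻¹ * g) : G ⧸ H)
      (dtransM (a⁻¹ * g) (origin H) (dprojM n k H (D.coordM X (a⁻¹ * g)))) :=
    (congrArg (dtransM a (QuotientGroup.mk (a⁻¹ * g) : G ⧸ H))
      (D.dtransM_dprojM_coordM X (a⁻¹ * g))).symm
  rw [dtransM_comp (n := n) _ _ (by rw [smul_mk, mul_one]), mul_inv_cancel_left] at h1
  exact h1

/-- The derivative of a function along a vector field, computed on the horizontal lift. -/
theorem mvfderiv_eq_leftDeriv {F : Type*} [NormedAddCommGroup F] [NormedSpace ℝ F]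
    {φ : G ⧸ H → F} {g : G} (hφ : MDifferentiableAt (𝓡 k) 𝓘(ℝ, F) φ (QuotientGroup.mk g))
    (X : VField k H) :
    mvfderiv (𝓡 k) φ (QuotientGroup.mk g) (X (QuotientGroup.mk g)) =
      leftDeriv (D.coordM X g) (fun a => φ (QuotientGroup.mk a)) g :=
  ((mvfderiv_comp_apply' (I := 𝓡 k) (I' := 𝓡 n) (f := φ)
    (φ := (QuotientGroup.mk : G → G ⧸ H)) g hφ (mdifferentiable_mk g)
      (leftVec g (D.coordM X g))).trans
    (congrArg (mvfderiv (𝓡 k) φ (QuotientGroup.mk g)) (D.mfderiv_mk_coordM X g))).symm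

theorem mdifferentiableAt_coordM {X : VField k H} (hX : IsSmoothField X) (g : G) :
    MDifferentiableAt (𝓡 n) 𝓘(ℝ, Model n) (D.coordM X) g :=
  (D.contMDiff_coordM hX g).mdifferentiableAt (by simp)

include D in
theorem isSmoothField_pushforward (g : G) {X : VField k H} (hX : IsSmoothField X) :
    IsSmoothField (pushforward g X) := by
  refine isSmoothField_of_lift (N := fun a => D.coordM X (g⁻¹ * a))
    ((D.contMDiff_coordM hX).comp (contMDiff_mul_left (I := 𝓡 n) (n := ∞))) fun a => ?_
  rw [← D.coordM_pushforward g X a]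
  exact (D.dtransM_dprojM_coordM _ a).symm

theorem isInvariantConnection_zeroOne : IsInvariantConnection (D.zeroOne Om) where
  smooth X Y hX hY := D.isSmoothField_zeroOne Om hX hY
  add_left X X' Y _ _ hY := D.field_ext fun g => by
    rw [coordM_add]
    simp only [D.coordM_zeroOne Om hY, coordM_add, leftDeriv, map_add, add_apply]
    abel
  smul_left φ X Y _ _ hY := D.field_ext fun g => by
    rw [coordM_fsmul]
    simp only [D.coordM_zeroOne Om hY, coordM_fsmul, leftDeriv, map_smul, smul_apply, smul_add]
  add_right X Y Y' _ hY hY' := D.field_ext fun g => by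
    have h : D.coordM (Y + Y') = D.coordM Y + D.coordM Y' := funext (D.coordM_add Y Y')
    have h2 : leftDeriv (D.coordM X g) (D.coordM Y + D.coordM Y') g =
        leftDeriv (D.coordM X g) (D.coordM Y) g + leftDeriv (D.coordM X g) (D.coordM Y') g := by
      rw [leftDeriv, mvfderiv_add (D.mdifferentiableAt_coordM hY g)
        (D.mdifferentiableAt_coordM hY' g)]
      rfl
    rw [coordM_add, D.coordM_zeroOne Om hY, D.coordM_zeroOne Om hY',
      D.coordM_zeroOne Om (isSmoothField_add hY hY'), h, h2, Pi.add_apply, map_add]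
    abel
  leibniz φ X Y hφ _ hY := D.field_ext fun g => by
    have h : D.coordM (fsmul φ Y) = fun a => ContinuousLinearMap.lsmul ℝ ℝ
      (φ (QuotientGroup.mk a)) (D.coordM Y a) := funext (D.coordM_fsmul φ Y)
    have hφ' : MDifferentiableAt (𝓡 n) 𝓘(ℝ, ℝ) (fun a => φ (QuotientGroup.mk a)) g :=
      ((hφ.comp contMDiff_mk) g).mdifferentiableAt (by simp)
    have h2 := mvfderiv_bilinear (ContinuousLinearMap.lsmul ℝ ℝ) hφ'
      (D.mdifferentiableAt_coordM hY g) (leftVec g (D.coordM X g))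
    have h3 := D.mvfderiv_eq_leftDeriv (g := g) ((hφ _).mdifferentiableAt (by simp)) X
    rw [coordM_add, coordM_fsmul, coordM_fsmul, D.coordM_zeroOne Om hY,
      D.coordM_zeroOne Om (isSmoothField_fsmul hφ hY), h3]
    rw [← h] at h2
    rw [coordM_fsmul, map_smul, smul_add, ← add_assoc]
    refine congrArg (· + _) (h2.trans ?_)
    rfl
  invariant g X Y _ hY := D.field_ext fun a => by
    have h : D.coordM (pushforward g Y) = fun z => D.coordM Y (g⁻¹ * z) :=
      funext (D.coordM_pushforward g Y)
    rw [coordM_pushforward, D.coordM_zeroOne Om hY,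
      D.coordM_zeroOne Om (D.isSmoothField_pushforward g hY), coordM_pushforward, h,
      leftDeriv_mul_left (D.contMDiff_coordM hY)]

end ReductiveDecomposition
end Connection

/-! ### Fundamental fields, brackets and curvature -/

section Curvature

variable {n k : ℕ} {G : Type*} [TopologicalSpace G] [Group G] [ChartedSpace (Model n) G]
  {H : Subgroup G} [ChartedSpace (Model k) (G ⧸ H)] [hs : IsHomogeneousSpace n k H]
  [LieGroup (𝓡 n) ∞ G] [IsManifold (𝓡 k) ∞ (G ⧸ H)]

/-- The fundamental field of `x` is the projection of the right-invariant field of `x`. -/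
theorem fundamentalField_mk (x : Model n) (g : G) :
    (fundamentalField (n := n) (x : GroupLieAlgebra (𝓡 n) G) : VField k H) (QuotientGroup.mk g) =
      dtransM g (origin H) (dprojM n k H (adInv x g)) := by
  have h1 := mfderiv_comp_apply_of_eq (I := 𝓡 n) (I' := 𝓡 n) (I'' := 𝓡 k) (1 : G)
    (mdifferentiable_mk (k := k) (H := H) g) (mdifferentiable_mul_right' g 1) (one_mul g) x
  have h2 := mfderiv_mul_right_leftVec 1 g x
  rw [leftVec_one] at h2
  have h3 : ∀ a : G, a = g → ∀ w : Model n, w = leftVec a (adM g⁻¹ x) →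
      mfderiv (𝓡 n) (𝓡 k) (QuotientGroup.mk : G → G ⧸ H) g w =
        dtransM g (origin H) (dprojM n k H (adInv x g)) := by
    rintro a rfl w rfl
    exact mfderiv_mk_leftVec a _
  exact h1.trans (h3 _ (one_mul g) _ h2)

theorem isSmoothField_fundamentalField (x : Model n) :
    IsSmoothField (fundamentalField (n := n) (x : GroupLieAlgebra (𝓡 n) G) : VField k H) :=
  isSmoothField_of_lift (contMDiff_adInv x) (fundamentalField_mk x)

/-- The bracket of two vector fields on `G ⧸ H`, in terms of lifts to `G`. -/
theorem mlieBracket_mk {X Y : VField k H} {a b : G → Model n}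
    (ha : ContMDiff (𝓡 n) 𝓘(ℝ, Model n) ∞ a) (hb : ContMDiff (𝓡 n) 𝓘(ℝ, Model n) ∞ b)
    (hX : ∀ g, X (QuotientGroup.mk g) = dtransM g (origin H) (dprojM n k H (a g)))
    (hY : ∀ g, Y (QuotientGroup.mk g) = dtransM g (origin H) (dprojM n k H (b g))) (g : G) :
    mlieBracket (𝓡 k) X Y (QuotientGroup.mk g) = dtransM g (origin H) (dprojM n k H
      (leftDeriv (a g) b g - leftDeriv (b g) a g + lieB G (a g) (b g))) := by
  have h := mfderiv_mlieBracket_of_related (contMDiff_mk (k := k) (H := H) g)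
    (mdifferentiableAt_leftVec ha g) (mdifferentiableAt_leftVec hb g)
    ((isSmoothField_of_lift ha hX _).mdifferentiableAt (by simp))
    ((isSmoothField_of_lift hb hY _).mdifferentiableAt (by simp))
    (fun g => (mfderiv_mk_leftVec g _).trans (hX g).symm)
    (fun g => (mfderiv_mk_leftVec g _).trans (hY g).symm)
  rw [mlieBracket_leftVec ha hb] at h
  exact h.symm.trans (mfderiv_mk_leftVec g _)

namespace ReductiveDecomposition

variable (D : ReductiveDecomposition n k H) (Om : InvariantSymplecticForm k H)

theorem coordM_fundamentalField (x : Model n) (g : G) :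
    D.coordM (fundamentalField (n := n) (x : GroupLieAlgebra (𝓡 n) G)) g = D.prM (adInv x g) :=
  D.coordM_eq_prM _ g (fundamentalField_mk x g)

theorem coordM_fundamentalField_one {x : Model n} (hx : x ∈ D.mM) :
    D.coordM (fundamentalField (n := n) (x : GroupLieAlgebra (𝓡 n) G)) 1 = x := by
  rw [coordM_fundamentalField, adInv_one, D.prM_of_mem hx]

theorem liftM_dtransM_one (x : Model n) :
    D.liftM (dtransM (1 : G) (origin H) (dprojM n k H x)) = D.prM x := by
  rw [dtransM_one, liftM_dprojM]

theorem connectionProduct_zeroOne (x y : D.m) :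
    D.connectionProduct (D.zeroOne Om) x y = D.productL Om 0 1 x y := by
  set x' : Model n := D.toModel x with hx'
  set y' : Model n := D.toModel y with hy'
  have hx : x' ∈ D.mM := x.2
  have hy : y' ∈ D.mM := y.2
  set X : VField k H := fundamentalField (n := n) (x' : GroupLieAlgebra (𝓡 n) G) with hX
  set Y : VField k H := fundamentalField (n := n) (y' : GroupLieAlgebra (𝓡 n) G) with hY
  have hYs : IsSmoothField Y := isSmoothField_fundamentalField y'
  have e1 : D.liftM (D.zeroOne Om X Y (origin H)) =
      D.prM (-lieB G x' y') + D.prodM Om x' y' := by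
    refine (congrArg D.liftM (D.zeroOne_mk Om hYs 1)).trans ((D.liftM_dtransM_one _).trans ?_)
    rw [D.prM_of_mem (D.nablaCoord_mem Om hYs 1), nablaCoord_eq, D.coordM_fundamentalField_one hx,
      D.coordM_fundamentalField_one hy, funext (D.coordM_fundamentalField y')]
    congr 1
    have h := mvfderiv_clm_comp D.prM (mdifferentiableAt_adInv y' (1 : G)) (leftVec 1 x')
    have h2 := leftDeriv_adInv x' y' (1 : G)
    rw [adInv_one] at h2
    exact h.trans (congrArg D.prM h2)
  have e2 : D.liftM (mlieBracket (𝓡 k) X Y (origin H)) = D.prM (-lieB G x' y') := by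
    refine (congrArg D.liftM (mlieBracket_mk (contMDiff_adInv x') (contMDiff_adInv y')
      (fundamentalField_mk x') (fundamentalField_mk y') 1)).trans
      ((D.liftM_dtransM_one _).trans (congrArg D.prM ?_))
    rw [leftDeriv_adInv, leftDeriv_adInv, adInv_one, adInv_one, lieB_skew y' x']
    abel
  have e3 : D.toModel (D.connectionProduct (D.zeroOne Om) x y) =
      D.liftM (D.zeroOne Om X Y (origin H)) - D.liftM (mlieBracket (𝓡 k) X Y (origin H)) :=
    D.liftM.map_sub _ _
  have e4 : D.toModel (D.connectionProduct (D.zeroOne Om) x y) =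
      D.toModel (D.productL Om 0 1 x y) := by
    rw [e3, e1, e2, add_sub_cancel_left, hx', hy', prodM_coe]
  exact Subtype.ext e4

/-- The function of `[X, Y]`. -/
theorem coordM_mlieBracket {X Y : VField k H} (hX : IsSmoothField X) (hY : IsSmoothField Y)
    (g : G) : D.coordM (mlieBracket (𝓡 k) X Y) g = leftDeriv (D.coordM X g) (D.coordM Y) g -
      leftDeriv (D.coordM Y g) (D.coordM X) g + D.prM (lieB G (D.coordM X g) (D.coordM Y g)) := by
  rw [D.coordM_eq_prM _ g (mlieBracket_mk (D.contMDiff_coordM hX) (D.contMDiff_coordM hY)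
    (fun g => (D.dtransM_dprojM_coordM X g).symm) (fun g => (D.dtransM_dprojM_coordM Y g).symm) g),
    map_add, map_sub, D.prM_of_mem (D.leftDeriv_mem (D.contMDiff_coordM hY) (D.coordM_mem Y) _ _),
    D.prM_of_mem (D.leftDeriv_mem (D.contMDiff_coordM hX) (D.coordM_mem X) _ _)]

/-- The projection `x ↦ x_𝔥`, as an endomorphism of the model space. -/
def prH : Model n →L[ℝ] Model n := ContinuousLinearMap.id ℝ _ - D.prM

theorem prH_apply (x : Model n) : D.prH x = x - D.prM x := rfl

theorem dprojM_prH (x : Model n) : dprojM n k H (D.prH x) = 0 := by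
  rw [prH_apply, map_sub, dprojM_prM, sub_self]

theorem coe_projH (x : Model n) : (D.projH x : GroupLieAlgebra (𝓡 n) G) = D.prH x :=
  (eq_sub_of_add_eq (Submodule.projection_add_projection_eq_self D.isCompl
    (x : GroupLieAlgebra (𝓡 n) G)))

/-- The curvature of the zero-one connection at the base point, as a trilinear map on `𝔪`. -/
def curvM (x y z : Model n) : Model n :=
  -lieB G (D.prH (lieB G x y)) z + D.prodM Om x (D.prodM Om y z) - D.prodM Om y (D.prodM Om x z)
    - D.prodM Om (D.prM (lieB G x y)) z

/-- The function of `∇_X ∇_Y Z`. -/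
theorem coordM_zeroOne_zeroOne {X Y Z : VField k H} (hY : IsSmoothField Y) (hZ : IsSmoothField Z)
    (g : G) : D.coordM (D.zeroOne Om X (D.zeroOne Om Y Z)) g =
      leftDeriv (D.coordM X g) (fun a => leftDeriv (D.coordM Y a) (D.coordM Z) a) g
      + (D.prodM Om (leftDeriv (D.coordM X g) (D.coordM Y) g) (D.coordM Z g)
        + D.prodM Om (D.coordM Y g) (leftDeriv (D.coordM X g) (D.coordM Z) g))
      + (D.prodM Om (D.coordM X g) (leftDeriv (D.coordM Y g) (D.coordM Z) g)
        + D.prodM Om (D.coordM X g) (D.prodM Om (D.coordM Y g) (D.coordM Z g))) := by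
  rw [D.coordM_zeroOne Om (D.isSmoothField_zeroOne Om hY hZ), D.coordM_zeroOne Om hZ, map_add,
    funext (D.coordM_zeroOne Om hZ)]
  congr 1
  have h1 : MDifferentiableAt (𝓡 n) 𝓘(ℝ, Model n)
      (fun a => leftDeriv (D.coordM Y a) (D.coordM Z) a) g :=
    (contMDiff_leftDeriv (D.contMDiff_coordM hY) (D.contMDiff_coordM hZ) g).mdifferentiableAt
      (by simp)
  have h2 : MDifferentiableAt (𝓡 n) 𝓘(ℝ, Model n)
      (fun a => D.prodM Om (D.coordM Y a) (D.coordM Z a)) g :=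
    ((((D.prodM Om).contMDiff.comp (D.contMDiff_coordM hY)).clm_apply
      (D.contMDiff_coordM hZ)) g).mdifferentiableAt (by simp)
  have h3 := congrArg (fun L : TangentSpace (𝓡 n) g →L[ℝ] Model n =>
    L (leftVec g (D.coordM X g))) (mvfderiv_add h1 h2)
  refine h3.trans (congrArg (_ + ·) (mvfderiv_bilinear (D.prodM Om)
    (D.mdifferentiableAt_coordM hY g) (D.mdifferentiableAt_coordM hZ g) _))

/-- The second derivatives of `f_Z` in `K(X, Y) Z` add up to its derivative along the bracket of the
horizontal lifts of `X` and `Y`. This bracket differs from the horizontal lift of `[X, Y]` by the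
`𝔥`-component of `[f_X, f_Y]`, along which the derivative of `f_Z` is algebraic. -/
theorem coordM_curvature {X Y Z : VField k H} (hX : IsSmoothField X) (hY : IsSmoothField Y)
    (hZ : IsSmoothField Z) (g : G) : D.coordM (curvature (D.zeroOne Om) X Y Z) g =
      D.curvM Om (D.coordM X g) (D.coordM Y g) (D.coordM Z g) := by
  have ha := D.contMDiff_coordM hX
  have hb := D.contMDiff_coordM hY
  have hc := D.contMDiff_coordM hZ
  have h1 := mvfderiv_mlieBracket_apply (hc g) (mdifferentiableAt_leftVec ha g)
    (mdifferentiableAt_leftVec hb g)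
  rw [mlieBracket_leftVec ha hb] at h1
  have h2 : leftDeriv (leftDeriv (D.coordM X g) (D.coordM Y) g -
      leftDeriv (D.coordM Y g) (D.coordM X) g + lieB G (D.coordM X g) (D.coordM Y g))
      (D.coordM Z) g =
      leftDeriv (D.coordM X g) (fun a => leftDeriv (D.coordM Y a) (D.coordM Z) a) g -
      leftDeriv (D.coordM Y g) (fun a => leftDeriv (D.coordM X a) (D.coordM Z) a) g := h1
  have h3 := leftDeriv_of_isotropy (k := k) hc (fun g h hh => D.coordM_mul Z g hh)
    (D.dprojM_prH (lieB G (D.coordM X g) (D.coordM Y g))) g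
  have h4 : ∀ u v : Model n, leftDeriv (u + v) (D.coordM Z) g =
      leftDeriv u (D.coordM Z) g + leftDeriv v (D.coordM Z) g := fun u v => by
    simp only [leftDeriv, map_add]
  have h5 : lieB G (D.coordM X g) (D.coordM Y g) =
      D.prM (lieB G (D.coordM X g) (D.coordM Y g)) +
      D.prH (lieB G (D.coordM X g) (D.coordM Y g)) := by rw [prH_apply]; abel
  rw [h5, ← add_assoc, h4, h3, ← sub_eq_add_neg, sub_eq_iff_eq_add] at h2
  rw [curvature, coordM_sub, coordM_sub, D.coordM_zeroOne_zeroOne Om hY hZ,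
    D.coordM_zeroOne_zeroOne Om hX hZ, D.coordM_zeroOne Om hZ, D.coordM_mlieBracket hX hY,
    h2, curvM]
  simp only [map_add, map_sub, add_apply, sub_apply]
  abel

/-- The connection is flat if and only if its curvature vanishes at the base point. -/
theorem isFlat_zeroOne_iff_curvM : IsFlat (D.zeroOne Om) ↔
    ∀ x ∈ D.mM, ∀ y ∈ D.mM, ∀ z ∈ D.mM, D.curvM Om x y z = 0 := by
  constructor
  · intro h x hx y hy z hz
    have h1 := D.coordM_curvature Om (isSmoothField_fundamentalField x)
      (isSmoothField_fundamentalField y) (isSmoothField_fundamentalField z) 1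
    rw [D.coordM_fundamentalField_one hx, D.coordM_fundamentalField_one hy,
      D.coordM_fundamentalField_one hz, h _ _ _ (isSmoothField_fundamentalField x)
      (isSmoothField_fundamentalField y) (isSmoothField_fundamentalField z), coordM_zero] at h1
    exact h1.symm
  · intro h X Y Z hX hY hZ
    refine D.field_ext fun g => ?_
    rw [D.coordM_curvature Om hX hY hZ, coordM_zero]
    exact h _ (D.coordM_mem X g) _ (D.coordM_mem Y g) _ (D.coordM_mem Z g)

theorem curvM_mem {x y z : Model n} (hz : z ∈ D.mM) : D.curvM Om x y z ∈ D.mM :=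
  D.mM.sub_mem (D.mM.sub_mem (D.mM.add_mem (D.mM.neg_mem (D.lieB_mem (D.dprojM_prH _) hz))
    (D.prodM_mem Om _ _)) (D.prodM_mem Om _ _)) (D.prodM_mem Om _ _)

/-- As `L^{0,1}_x` is minus the `ω`-adjoint of `y ↦ [x, y]_𝔪`, the Jacobi identity reduces the
curvature to the `𝔥`-components of brackets. -/
theorem omM_curvM {x y z w : Model n} (hx : x ∈ D.mM) (hy : y ∈ D.mM) (hz : z ∈ D.mM)
    (hw : w ∈ D.mM) : omM Om (D.curvM Om x y z) w =
      omM Om (lieB G (D.prH (lieB G y w)) x - lieB G (D.prH (lieB G x w)) y) z := by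
  have e1 : ∀ a ∈ D.mM, ∀ b ∈ D.mM, omM Om (D.prodM Om a (D.prodM Om b z)) w =
      -omM Om (lieB G b (lieB G a w) - lieB G b (D.prH (lieB G a w))) z := by
    intro a ha b hb
    rw [D.omM_prodM Om ha (D.prodM_mem Om _ _) hw, omM_skew, ← D.omM_prM_right Om _ (lieB G a w),
      D.omM_prodM Om hb hz (D.prM_mem _), ← map_sub, prH_apply, sub_sub_cancel]
  have e2 : omM Om (D.prodM Om (D.prM (lieB G x y)) z) w =
      omM Om (lieB G (lieB G x y) w - lieB G (D.prH (lieB G x y)) w) z := by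
    rw [D.omM_prodM Om (D.prM_mem _) hz hw, ← LinearMap.sub_apply, ← map_sub, prH_apply,
      sub_sub_cancel]
  have e3 := omM_lieB_of_isotropy (G := G) Om (D.dprojM_prH (lieB G x y)) z w
  rw [omM_skew Om z] at e3
  have e4 := lieB_lieB (G := G) x y w
  have e5 : omM Om (lieB G (lieB G x y) w) z =
      omM Om (lieB G x (lieB G y w)) z - omM Om (lieB G y (lieB G x w)) z := by
    rw [e4]; simp
  rw [curvM]
  simp only [map_add, map_sub, map_neg, add_apply, sub_apply, neg_apply] at e1 e2 ⊢
  rw [e1 x hx y hy, e1 y hy x hx, e2, e5, lieB_skew y (D.prH _), lieB_skew x (D.prH _)]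
  simp only [map_neg, neg_apply]
  linarith

/-- Flatness of the zero-one connection, as a condition on the `𝔥`-components of brackets. -/
theorem isFlat_zeroOne_iff : IsFlat (D.zeroOne Om) ↔
    ∀ x ∈ D.mM, ∀ y ∈ D.mM, ∀ z ∈ D.mM, lieB G (D.prH (lieB G x y)) z = 0 := by
  rw [isFlat_zeroOne_iff_curvM]
  constructor
  · intro h
    have hsym : ∀ x ∈ D.mM, ∀ w ∈ D.mM, ∀ y ∈ D.mM,
        lieB G (D.prH (lieB G x w)) y = lieB G (D.prH (lieB G y w)) x := by
      intro x hx w hw y hy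
      symm
      rw [← sub_eq_zero]
      refine D.omM_nondegenerate Om (D.mM.sub_mem (D.lieB_mem (D.dprojM_prH _) hx)
        (D.lieB_mem (D.dprojM_prH _) hy)) fun z hz => ?_
      rw [← D.omM_curvM Om hx hy hz hw, h x hx y hy z hz, map_zero, zero_apply]
    have hskew : ∀ x w y : Model n, lieB G (D.prH (lieB G x w)) y =
        -lieB G (D.prH (lieB G w x)) y := by
      intro x w y
      rw [lieB_skew x w, map_neg, map_neg, LinearMap.neg_apply]
    intro x hx y hy z hz
    -- A trilinear map which is skew in two arguments and symmetric in two others vanishes.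
    have h0 := (hsym x hx y hy z hz).trans ((hskew z y x).trans (congrArg Neg.neg
      ((hsym y hy z hz x hx).trans ((hskew x z y).trans (congrArg Neg.neg
        ((hsym z hz x hx y hy).trans (hskew y x z)))))))
    rw [neg_neg] at h0
    have h1 : (2 : ℝ) • lieB G (D.prH (lieB G x y)) z = 0 := by
      rw [two_smul]
      nth_rewrite 1 [h0]
      exact neg_add_cancel _
    exact (smul_eq_zero.1 h1).resolve_left two_ne_zero
  · intro h x hx y hy z hz
    refine D.omM_nondegenerate Om (D.curvM_mem Om hz) fun w hw => ?_
    rw [D.omM_curvM Om hx hy hz hw, h x hx w hw y hy, h y hy w hw x hx, sub_zero, map_zero,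
      zero_apply]

theorem bracketCondition_iff : D.BracketCondition ↔
    ∀ x ∈ D.mM, ∀ y ∈ D.mM, ∀ z ∈ D.mM, lieB G (D.prH (lieB G x y)) z = 0 := by
  refine forall₂_congr fun x _ => forall₂_congr fun y _ => forall₂_congr fun z _ => ?_
  have h : ∀ v : GroupLieAlgebra (𝓡 n) G, ∀ w : Model n, v = w →
      (⁅v, (z : GroupLieAlgebra (𝓡 n) G)⁆ = 0 ↔ lieB G w z = 0) := by
    rintro v w rfl; rfl
  exact h _ _ (D.coe_projH (lieB G x y))

/-- The `𝔥`-components of brackets commute with `𝔪`, so they do not contribute to the Jacobi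
identity. -/
theorem isLieAlgebraM_of_forall
    (h : ∀ x ∈ D.mM, ∀ y ∈ D.mM, ∀ z ∈ D.mM, lieB G (D.prH (lieB G x y)) z = 0) :
    D.IsLieAlgebraM := by
  have hT : ∀ x ∈ D.mM, ∀ y ∈ D.mM, ∀ z ∈ D.mM,
      lieB G x (D.prM (lieB G y z)) = lieB G x (lieB G y z) := by
    intro x hx y hy z hz
    have h1 := h y hy z hz x hx
    rw [prH_apply, lieB_skew, map_sub, neg_eq_zero, sub_eq_zero] at h1
    exact h1.symm
  refine ⟨fun x => Subtype.ext ?_, fun x y z => Subtype.ext ?_⟩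
  · have h1 : D.prM (lieB G (D.toModel x) (D.toModel x)) = 0 := by rw [lieB_self, map_zero]
    exact h1
  · set x' : Model n := D.toModel x
    set y' : Model n := D.toModel y
    set z' : Model n := D.toModel z
    have hx : x' ∈ D.mM := x.2
    have hy : y' ∈ D.mM := y.2
    have hz : z' ∈ D.mM := z.2
    have h1 : D.prM (lieB G x' (D.prM (lieB G y' z'))) + D.prM (lieB G y' (D.prM (lieB G z' x')))
        + D.prM (lieB G z' (D.prM (lieB G x' y'))) = 0 := by
      rw [hT x' hx y' hy z' hz, hT y' hy z' hz x' hx, hT z' hz x' hx y' hy, ← map_add, ← map_add,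
        lieB_lieB x' y' z', lieB_skew z' (lieB G x' y'), lieB_skew z' x', map_neg]
      rw [add_neg_cancel_right, add_neg_cancel, map_zero]
    exact h1

end ReductiveDecomposition
end Curvature

/-! ### Almost effective actions -/

/-- Grönwall's inequality along segments: a function which vanishes at a point, and whose derivative
is bounded by a multiple of its norm, vanishes near the point. -/
theorem eventually_eq_zero_of_norm_fderiv_le {E F : Type*} [NormedAddCommGroup E] [NormedSpace ℝ E]
    [NormedAddCommGroup F] [NormedSpace ℝ F] {f : E → F} {a : E} {C : ℝ} (h0 : f a = 0)
    (h : ∀ᶠ z in 𝓝 a, DifferentiableAt ℝ f z ∧ ‖fderiv ℝ f z‖ ≤ C * ‖f z‖) :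
    ∀ᶠ z in 𝓝 a, f z = 0 := by
  obtain ⟨r, hr, hb⟩ := Metric.eventually_nhds_iff_ball.1 h
  filter_upwards [Metric.ball_mem_nhds a hr] with z hz
  have hseg : ∀ t ∈ Icc (0 : ℝ) 1, a + t • (z - a) ∈ Metric.ball a r := by
    intro t ht
    rw [mem_ball_iff_norm, add_sub_cancel_left, norm_smul, Real.norm_of_nonneg ht.1]
    rw [mem_ball_iff_norm] at hz
    exact (mul_le_of_le_one_left (norm_nonneg _) ht.2).trans_lt hz
  have hd : ∀ t ∈ Icc (0 : ℝ) 1, HasDerivAt (fun t : ℝ => f (a + t • (z - a)))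
      (fderiv ℝ f (a + t • (z - a)) (z - a)) t := by
    intro t ht
    have h1 : HasDerivAt (fun t : ℝ => a + t • (z - a)) (z - a) t := by
      simpa using ((hasDerivAt_id t).smul_const (z - a)).const_add a
    exact ((hb _ (hseg t ht)).1.hasFDerivAt).comp_hasDerivAt t h1
  have key := eq_zero_of_abs_deriv_le_mul_abs_self_of_eq_zero_right (K := C * ‖z - a‖)
    (fun t ht => (hd t ht).continuousAt.continuousWithinAt)
    (fun t ht => (hd t (Ico_subset_Icc_self ht)).hasDerivWithinAt) (by simpa using h0)
    (fun t ht => ((fderiv ℝ f (a + t • (z - a))).le_opNorm (z - a)).trans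
      ((mul_le_mul_of_nonneg_right (hb _ (hseg t (Ico_subset_Icc_self ht))).2
        (norm_nonneg _)).trans (le_of_eq (by ring)))) 1 (right_mem_Icc.2 zero_le_one)
  simpa using key

section Ideals

variable {n : ℕ} {G : Type*} [TopologicalSpace G] [Group G] [ChartedSpace (Model n) G]
  [LieGroup (𝓡 n) ∞ G]

/-- A bound for a linear map on `ℝⁿ` in terms of its values at vectors close to the standard
basis. -/
theorem norm_le_of_near_basis {F : Type*} [NormedAddCommGroup F] [NormedSpace ℝ F]
    (L : Model n →L[ℝ] F) (v : Fin n → Model n) {B : ℝ} (hB : 0 ≤ B)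
    (hv : ∀ i, ‖v i - EuclideanSpace.basisFun (Fin n) ℝ i‖ ≤ 1 / (2 * (n + 1)))
    (hL : ∀ i, ‖L (v i)‖ ≤ B) : ‖L‖ ≤ 2 * n * B := by
  set e : Fin n → Model n := fun i => EuclideanSpace.basisFun (Fin n) ℝ i with he
  have h1 : ∀ i, ‖L (e i)‖ ≤ B + ‖L‖ * (1 / (2 * (n + 1))) := by
    intro i
    have h2 : L (e i) = L (v i) - L (v i - e i) := by rw [map_sub, sub_sub_cancel]
    rw [h2]
    exact (norm_sub_le _ _).trans (add_le_add (hL i)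
      ((L.le_opNorm _).trans (mul_le_mul_of_nonneg_left (hv i) (norm_nonneg _))))
  have hC : 0 ≤ B + ‖L‖ * (1 / (2 * ((n : ℝ) + 1))) := by positivity
  have h3 : ‖L‖ ≤ n * (B + ‖L‖ * (1 / (2 * (n + 1)))) := by
    refine L.opNorm_le_bound (by positivity) fun w => ?_
    have hw : w = ∑ i, w i • e i := ((EuclideanSpace.basisFun (Fin n) ℝ).sum_repr w).symm
    calc ‖L w‖ = ‖∑ i, w i • L (e i)‖ := by
          conv_lhs => rw [hw, map_sum]
          simp only [map_smul]
      _ ≤ ∑ i, ‖w i • L (e i)‖ := norm_sum_le _ _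
      _ ≤ ∑ _i : Fin n, ‖w‖ * (B + ‖L‖ * (1 / (2 * (n + 1)))) :=
          Finset.sum_le_sum fun i _ => by
            rw [norm_smul]
            exact mul_le_mul (PiLp.norm_apply_le w i) (h1 i) (norm_nonneg _) (norm_nonneg _)
      _ = n * (B + ‖L‖ * (1 / (2 * (n + 1)))) * ‖w‖ := by
          rw [Finset.sum_const, Finset.card_univ, Fintype.card_fin, nsmul_eq_mul]; ring
  have h4 : (n : ℝ) * (‖L‖ * (1 / (2 * (n + 1)))) ≤ ‖L‖ / 2 := by
    have h5 : (n : ℝ) / (n + 1) ≤ 1 := (div_le_one (by positivity)).2 (by linarith)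
    calc (n : ℝ) * (‖L‖ * (1 / (2 * (n + 1)))) = ‖L‖ / 2 * (n / (n + 1)) := by
          field_simp
      _ ≤ ‖L‖ / 2 * 1 := mul_le_mul_of_nonneg_left h5 (by positivity)
      _ = ‖L‖ / 2 := mul_one _
  linarith

/-- A function on a Lie group which satisfies a linear first order system in left-invariant
directions and vanishes at `1` vanishes near `1`. -/
theorem eventually_eq_zero_of_leftDeriv {F : Type*} [NormedAddCommGroup F] [NormedSpace ℝ F]
    {f : G → F} (hf : ContMDiff (𝓡 n) 𝓘(ℝ, F) ∞ f) (h1 : f 1 = 0) (A : Model n → F →L[ℝ] F)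
    (hA : ∀ x g, leftDeriv x f g = A x (f g)) : ∀ᶠ g in 𝓝 (1 : G), f g = 0 := by
  set χ := extChartAt (𝓡 n) (1 : G) with hχ
  set e : Fin n → Model n := fun i => EuclideanSpace.basisFun (Fin n) ℝ i with he
  set N : Fin n → Model n → Model n := fun i => chartField (𝓡 n) (fun g : G => leftVec g (e i)) 1
    with hN
  -- The left-invariant fields of the basis vectors are close to a constant frame near `1`.
  have hN0 : ∀ i, N i (χ 1) = e i := fun i =>
    (chartField_self (I := 𝓡 n) (fun g : G => leftVec g (e i)) 1).trans (leftVec_one (e i))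
  have hNc : ∀ i, ∀ᶠ z in 𝓝 (χ 1), ‖N i z - e i‖ ≤ 1 / (2 * (n + 1)) := by
    intro i
    have h2 : ContinuousAt (N i) (χ 1) := (differentiableAt_chartField
      (mdifferentiableAt_leftVec_const (e i) (1 : G))).continuousAt
    have h3 : Filter.Tendsto (fun z => ‖N i z - e i‖) (𝓝 (χ 1)) (𝓝 ‖N i (χ 1) - e i‖) :=
      (h2.sub_const (e i)).norm
    rw [hN0, sub_self, norm_zero] at h3
    exact h3.eventually (eventually_le_nhds (by positivity))
  have hder : ∀ i, ∀ᶠ z in 𝓝 (χ 1), fderiv ℝ (f ∘ χ.symm) z (N i z) = A (e i) (f (χ.symm z)) := by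
    intro i
    filter_upwards [mvfderiv_field_eventually (I := 𝓡 n) (fun g : G => leftVec g (e i)) (x := 1)
      (eventually_mdifferentiableAt (hf 1))] with z hz
    exact hz.symm.trans (hA _ _)
  have hdiff : ∀ᶠ z in 𝓝 (χ 1), DifferentiableAt ℝ (f ∘ χ.symm) z := by
    have h2 := contDiffAt_comp_extChartAt_symm (hf 1)
    filter_upwards [(h2.of_le (m := 1) (by simp)).eventually (by simp)] with z hz
    exact hz.differentiableAt (by simp)
  have hzero : ∀ᶠ z in 𝓝 (χ 1), (f ∘ χ.symm) z = 0 := by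
    refine eventually_eq_zero_of_norm_fderiv_le (C := 2 * n * ∑ i, ‖A (e i)‖) ?_ ?_
    · rw [Function.comp_apply, hχ, extChartAt_to_inv, h1]
    · filter_upwards [hdiff, Filter.eventually_all.2 hNc, Filter.eventually_all.2 hder]
        with z hz1 hz2 hz3
      refine ⟨hz1, ?_⟩
      rw [mul_assoc]
      refine norm_le_of_near_basis _ (fun i => N i z) (by positivity) hz2 fun i => ?_
      rw [hz3]
      refine ((A (e i)).le_opNorm _).trans (mul_le_mul_of_nonneg_right ?_ (norm_nonneg _))
      exact Finset.single_le_sum (f := fun i => ‖A (e i)‖) (fun i _ => norm_nonneg _)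
        (Finset.mem_univ i)
  filter_upwards [(continuousAt_extChartAt (I := 𝓡 n) (1 : G)).eventually hzero,
    extChartAt_source_mem_nhds (I := 𝓡 n) (1 : G)] with g hg hgs
  rwa [Function.comp_apply, hχ, (extChartAt (𝓡 n) (1 : G)).left_inv hgs] at hg

/-- An ideal of the Lie algebra is stable under the adjoint action of a neighbourhood of `1`. -/
theorem eventually_adInv_mem {K : Submodule ℝ (Model n)}
    (hK : ∀ x, ∀ v ∈ K, lieB G x v ∈ K) : ∀ᶠ g in 𝓝 (1 : G), ∀ v ∈ K, adInv v g ∈ K := by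
  obtain ⟨K', hK'⟩ := K.exists_isCompl
  set P : Model n →L[ℝ] Model n := LinearMap.toContinuousLinearMap
    (K'.projection K hK'.symm) with hP
  have hP0 : ∀ x, P x = 0 ↔ x ∈ K := fun x => Submodule.projection_apply_eq_zero_iff hK'.symm
  have hPP : ∀ x, P (P x) = P x := fun x =>
    Submodule.projection_apply_left hK'.symm (K'.projectionOnto K hK'.symm x)
  -- As `K` is an ideal, `P [x, w]` depends on `P w` only. So `g ↦ P (Ad(g⁻¹) v)` satisfies a linear
  -- system of differential equations.
  have hPl : ∀ x w : Model n, P (lieB G x w) = P (lieB G x (P w)) := by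
    intro x w
    rw [← sub_eq_zero, ← map_sub, ← map_sub, hP0]
    refine hK x _ ((hP0 _).1 ?_)
    rw [map_sub, hPP, sub_self]
  have hone : ∀ v ∈ K, ∀ᶠ g in 𝓝 (1 : G), adInv v g ∈ K := by
    intro v hv
    have h := eventually_eq_zero_of_leftDeriv (G := G) (f := fun g => P (adInv v g))
      (P.contMDiff.comp (contMDiff_adInv v)) (by rw [adInv_one, hP0]; exact hv)
      (fun x => -(P ∘L LinearMap.toContinuousLinearMap (lieB G x))) (fun x g => ?_)
    · filter_upwards [h] with g hg
      exact (hP0 _).1 hg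
    · have h2 := mvfderiv_clm_comp P (mdifferentiableAt_adInv v g) (leftVec g x)
      refine h2.trans ((congrArg P (leftDeriv_adInv x v g)).trans ?_)
      rw [map_neg, hPl]
      rfl
  obtain ⟨s, hs⟩ := IsNoetherian.noetherian K
  have hall : ∀ᶠ g in 𝓝 (1 : G), ∀ v ∈ s, adInv v g ∈ K :=
    (Filter.eventually_all_finset s).2 fun v hv => hone v (hs ▸ Submodule.subset_span hv)
  filter_upwards [hall] with g hg v hv
  have h2 : K ≤ K.comap ((adM g⁻¹ : Model n →L[ℝ] Model n) : Model n →ₗ[ℝ] Model n) := by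
    conv_lhs => rw [← hs]
    exact Submodule.span_le.2 hg
  exact h2 hv

variable (G) in
/-- The stabiliser of a subspace of the Lie algebra under the adjoint action. The equivalence in the
definition, rather than an implication, makes closure under inverses evident. -/
def adStabilizer (K : Submodule ℝ (Model n)) : Subgroup G where
  carrier := {g | ∀ v, adM g v ∈ K ↔ v ∈ K}
  mul_mem' {a b} ha hb v := by rw [adM_mul, ha, hb]
  one_mem' v := by rw [adM_one]
  inv_mem' {a} ha v := by rw [← ha, adM_adM_inv]

theorem isOpen_adStabilizer {K : Submodule ℝ (Model n)}
    (hK : ∀ x, ∀ v ∈ K, lieB G x v ∈ K) : IsOpen (adStabilizer G K : Set G) := by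
  have : IsTopologicalGroup G := topologicalGroup_of_lieGroup (𝓡 n) ∞
  refine Subgroup.isOpen_of_mem_nhds _ (g := 1) ?_
  have h1 := eventually_adInv_mem hK
  have h2 : ∀ᶠ g in 𝓝 (1 : G), ∀ v ∈ K, adInv v g⁻¹ ∈ K := by
    have h3 : Filter.Tendsto (fun g : G => g⁻¹) (𝓝 1) (𝓝 1) := by
      simpa using (continuous_inv (G := G)).tendsto 1
    exact h3.eventually h1
  filter_upwards [h1, h2] with g hg1 hg2
  intro v
  constructor
  · intro hv
    have := hg1 _ hv
    rwa [adInv, adM_inv_adM] at this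
  · intro hv
    have := hg2 _ hv
    rwa [adInv, inv_inv] at this

end Ideals

/-- An open subgroup which contains `H` is everything, if `G ⧸ H` is connected. -/
theorem eq_top_of_isOpen_of_le {G : Type*} [TopologicalSpace G] [Group G] [IsTopologicalGroup G]
    {H S : Subgroup G} [ConnectedSpace (G ⧸ H)] (hS : IsOpen (S : Set G)) (hHS : H ≤ S) :
    S = ⊤ := by
  have hpre : (QuotientGroup.mk : G → G ⧸ H) ⁻¹' (QuotientGroup.mk '' (S : Set G)) = S := by
    ext g
    constructor
    · rintro ⟨s, hs, hsg⟩
      have := S.mul_mem hs (hHS (QuotientGroup.eq.1 hsg))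
      simpa using this
    · exact fun hg => ⟨g, hg, rfl⟩
  have hclopen : IsClopen ((QuotientGroup.mk : G → G ⧸ H) '' (S : Set G)) := by
    rw [← (QuotientGroup.isQuotientMap_mk (N := H)).isClopen_preimage, hpre]
    exact ⟨S.isClosed_of_isOpen hS, hS⟩
  have huniv := hclopen.eq_univ ⟨QuotientGroup.mk 1, 1, S.one_mem, rfl⟩
  rw [huniv, preimage_univ] at hpre
  exact SetLike.coe_injective hpre.symm

section AlmostEffective

variable {n k : ℕ} {G : Type*} [TopologicalSpace G] [Group G] [ChartedSpace (Model n) G]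
  {H : Subgroup G} [ChartedSpace (Model k) (G ⧸ H)] [hs : IsHomogeneousSpace n k H]
  [LieGroup (𝓡 n) ∞ G] [IsManifold (𝓡 k) ∞ (G ⧸ H)]

/-- If the group acts almost effectively, then `0` is the only vector all of whose images under the
adjoint action are tangent to `H`. -/
theorem eq_zero_of_forall_dprojM_adM (hH : ActsAlmostEffectively H) {v : Model n}
    (hv : ∀ b : G, dprojM n k H (adM b⁻¹ v) = 0) : v = 0 := by
  obtain ⟨ε, hε, c, hc0, hc⟩ := exists_integral_curve (1 : G)
    (contMDiff_leftVec (a := fun _ : G => v) contMDiff_const)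
  have hcore : ∀ t ∈ Ioo (-ε) ε, c t ∈ H.normalCore := by
    intro t ht b
    have h1 := mk_mul_eq_of_integral_curve hc (hv b⁻¹) ht
    rw [hc0, one_mul, eq_comm, QuotientGroup.eq, inv_inv, ← mul_assoc] at h1
    exact h1
  have h0 : (0 : ℝ) ∈ Ioo (-ε) ε := by constructor <;> linarith
  have hcd := hc 0 h0
  have hdisc : DiscreteTopology H.normalCore := hH
  obtain ⟨U, hU, hU1⟩ := isOpen_induced_iff.1 (isOpen_discrete ({1} : Set H.normalCore))
  have h1U : (1 : G) ∈ U := by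
    have : (1 : H.normalCore) ∈ Subtype.val ⁻¹' U := by rw [hU1]; rfl
    exact this
  have hconst : ∀ᶠ t in 𝓝 (0 : ℝ), c t = 1 := by
    filter_upwards [hcd.continuousAt.eventually_mem (hU.mem_nhds (hc0.symm ▸ h1U)),
      Ioo_mem_nhds h0.1 h0.2] with t ht ht'
    have : (⟨c t, hcore t ht'⟩ : H.normalCore) ∈ Subtype.val ⁻¹' U := ht
    rw [hU1] at this
    exact congrArg Subtype.val this
  have h2 : HasMFDerivAt 𝓘(ℝ, ℝ) (𝓡 n) c 0 (0 : ℝ →L[ℝ] Model n) :=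
    (hasMFDerivAt_const (I := 𝓘(ℝ, ℝ)) (I' := 𝓡 n) (1 : G) (0 : ℝ)).congr_of_eventuallyEq hconst
  have h3 := hasMFDerivAt_unique hcd h2
  have h4 : leftVec (c 0) v = (0 : Model n) := by
    have h5 := congrArg (fun L : ℝ →L[ℝ] Model n => L 1) h3
    have h6 : ∀ w : Model n, ((1 : ℝ →L[ℝ] ℝ).smulRight w) 1 = w := fun w => by simp
    exact (h6 _).symm.trans h5
  exact leftVec_injective (c 0) (h4.trans (ContinuousLinearMap.map_zero (leftVec (c 0))).symm)

namespace ReductiveDecomposition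

variable (D : ReductiveDecomposition n k H)

/-- The centraliser of `𝔪` in `𝔥`. -/
def centralizerM : Submodule ℝ (Model n) where
  carrier := {v | dprojM n k H v = 0 ∧ ∀ y ∈ D.mM, lieB G v y = 0}
  add_mem' {v w} hv hw := ⟨by rw [map_add, hv.1, hw.1, add_zero], fun y hy => by
    rw [map_add, LinearMap.add_apply, hv.2 y hy, hw.2 y hy, add_zero]⟩
  zero_mem' := ⟨map_zero _, fun y _ => by rw [map_zero, LinearMap.zero_apply]⟩
  smul_mem' c v hv := ⟨by rw [map_smul, hv.1, smul_zero], fun y hy => by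
    rw [map_smul, LinearMap.smul_apply, hv.2 y hy, smul_zero]⟩

/-- The centraliser of `𝔪` in `𝔥` is an ideal of `𝔤`: it is annihilated by `𝔪`, and preserved by `𝔥`
since `[𝔥, 𝔪] ⊆ 𝔪`. -/
theorem lieB_mem_centralizerM (x : Model n) {v : Model n} (hv : v ∈ D.centralizerM) :
    lieB G x v ∈ D.centralizerM := by
  have h1 : lieB G (D.prM x) v = 0 := by
    rw [lieB_skew, hv.2 _ (D.prM_mem x), neg_zero]
  have h2 : lieB G x v = lieB G (D.prH x) v := by
    rw [prH_apply, map_sub, LinearMap.sub_apply, h1, sub_zero]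
  rw [h2]
  refine ⟨?_, fun y hy => ?_⟩
  · rw [← D.prM_eq_zero_iff, D.prM_lieB_of_isotropy (D.dprojM_prH x),
      D.prM_eq_zero_iff.2 hv.1, map_zero]
  · have h3 := lieB_lieB (G := G) (D.prH x) v y
    rw [hv.2 y hy, map_zero, hv.2 _ (D.lieB_mem (D.dprojM_prH x) hy), add_zero] at h3
    exact h3.symm

theorem le_adStabilizer_centralizerM : H ≤ adStabilizer G D.centralizerM := by
  have key : ∀ h ∈ H, ∀ v ∈ D.centralizerM, adM h v ∈ D.centralizerM := by
    intro h hh v hv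
    refine ⟨?_, fun y hy => ?_⟩
    · rw [← dtransM_dprojM hh, hv.1, map_zero]
    · rw [← adM_adM_inv h y, ← adM_lieB, hv.2 _ (D.adM_mem (inv_mem hh) hy), map_zero]
  intro h hh v
  refine ⟨fun hv => ?_, key h hh v⟩
  have := key h⁻¹ (inv_mem hh) _ hv
  rwa [adM_inv_adM] at this

/-- The centraliser of `𝔪` in `𝔥` is stable under `Ad(G)`, so it generates flows which fix all
points of `G ⧸ H`. -/
theorem centralizerM_eq_zero [ConnectedSpace (G ⧸ H)] (hH : ActsAlmostEffectively H)
    {v : Model n} (hv : v ∈ D.centralizerM) : v = 0 := by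
  have : IsTopologicalGroup G := topologicalGroup_of_lieGroup (𝓡 n) ∞
  have htop := eq_top_of_isOpen_of_le
    (isOpen_adStabilizer fun x v hv => D.lieB_mem_centralizerM x hv) D.le_adStabilizer_centralizerM
  refine eq_zero_of_forall_dprojM_adM (k := k) hH fun b => ?_
  have hb : b⁻¹ ∈ adStabilizer G D.centralizerM := htop ▸ Subgroup.mem_top _
  exact ((hb v).2 hv).1

/-- If `[[𝔪, 𝔪]_𝔥, 𝔪] = 0`, then `[𝔪, 𝔪]_𝔥` centralises `𝔪`, and hence vanishes. -/
theorem isIdealM_of_forall [ConnectedSpace (G ⧸ H)] (hH : ActsAlmostEffectively H)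
    (h : ∀ x ∈ D.mM, ∀ y ∈ D.mM, ∀ z ∈ D.mM, lieB G (D.prH (lieB G x y)) z = 0) :
    D.IsIdealM := by
  have key : ∀ x : Model n, ∀ y ∈ D.mM, lieB G x y ∈ D.mM := by
    intro x y hy
    have h1 : D.prH (lieB G (D.prM x) y) = 0 := D.centralizerM_eq_zero hH
      ⟨D.dprojM_prH _, fun z hz => h _ (D.prM_mem x) y hy z hz⟩
    have h2 : lieB G x y = D.prM (lieB G (D.prM x) y) + lieB G (D.prH x) y := by
      rw [prH_apply, sub_eq_zero] at h1
      rw [← h1, ← LinearMap.add_apply, ← map_add, prH_apply, add_sub_cancel]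
    rw [h2]
    exact D.mM.add_mem (D.prM_mem _) (D.lieB_mem (D.dprojM_prH x) hy)
  exact key

theorem forall_of_isIdealM (h : D.IsIdealM) :
    ∀ x ∈ D.mM, ∀ y ∈ D.mM, ∀ z ∈ D.mM, lieB G (D.prH (lieB G x y)) z = 0 := by
  intro x _ y hy z _
  have h1 : lieB G x y ∈ D.mM := h x y hy
  rw [prH_apply, D.prM_of_mem h1, sub_self, map_zero, LinearMap.zero_apply]

end ReductiveDecomposition
end AlmostEffective

end ReductiveHomogeneous

end

theorem mainTheorem5 {n k : ℕ} {G : Type*} [TopologicalSpace G] [Group G]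
    [ChartedSpace (ReductiveHomogeneous.Model n) G] [LieGroup (𝓡 n) ∞ G]
    (H : Subgroup G) [ChartedSpace (ReductiveHomogeneous.Model k) (G ⧸ H)]
    [IsManifold (𝓡 k) ∞ (G ⧸ H)] [ReductiveHomogeneous.IsHomogeneousSpace n k H]
    (D : ReductiveHomogeneous.ReductiveDecomposition n k H)
    (Om : ReductiveHomogeneous.InvariantSymplecticForm k H) :
    (ReductiveHomogeneous.IsInvariantConnection (D.zeroOne Om) ∧
      ∀ x y : D.m, D.connectionProduct (D.zeroOne Om) x y = D.productL Om 0 1 x y) ∧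
    (ReductiveHomogeneous.IsFlat (D.zeroOne Om) ↔ D.BracketCondition) ∧
    (ReductiveHomogeneous.IsFlat (D.zeroOne Om) → D.IsLieAlgebraM) ∧
    (ConnectedSpace (G ⧸ H) → ReductiveHomogeneous.ActsAlmostEffectively H →
      (ReductiveHomogeneous.IsFlat (D.zeroOne Om) ↔ D.IsIdealM)) := by
  refine ⟨⟨D.isInvariantConnection_zeroOne Om, D.connectionProduct_zeroOne Om⟩,
    (D.isFlat_zeroOne_iff Om).trans D.bracketCondition_iff.symm,
    fun h => D.isLieAlgebraM_of_forall ((D.isFlat_zeroOne_iff Om).1 h),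
    fun hconn hH => (D.isFlat_zeroOne_iff Om).trans
      ⟨D.isIdealM_of_forall hH, D.forall_of_isIdealM⟩⟩
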